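/- Let $r_0\ge r_2\ge r_4\ge\cdots$ be integers with $r_0\ge 1$ and $r_{2n}=0$ for all large $n$. For a quadratic form $u$ on a finite-dimensional vector space $\mathcal V$ over a finite field, with associated bilinear form $(x,y)=u(x+y)-u(x)-u(y)$, say that $u$ is *nondegenerate* if the restriction of $u$ to the radical $\{x\in\mathcal V:(x,\mathcal V)=0\}$ is injective. If $\dim\mathcal V$ is even and at least $2$ and $u$ is nondegenerate, its type $\eta_u$ is $1$ if $u$ is identically $0$ on some subspace of dimension $\tfrac12\dim\mathcal V$, and $-1$ otherwise. Let $X(\mathcal V,u)$ be the number of sequences $U_0\supseteq U_2\supseteq U_4\supseteq\cdots$ of subspaces of $\mathcal V$ such that for every $n\ge 0$ we have $\dim U_{2n}=r_{2n}$ and the restriction $u|_{U_{2n}}$ is nondegenerate. (1) If $r_0$ is odd, there is a polynomial $P\in\mathbf Z[t]$, depending only on $(r_0,r_2,r_4,\dots)$, such that for every finite field $\mathbf F_q$ (of any characteristic $p$) and every $r_0$-dimensional $\mathbf F_q$-vector space $\mathcal V$ with a nondegenerate quadratic form $u$, the number $X(\mathcal V,u)$ is finite and equals $P(q)$. (2)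 If $r_0$ is even, $r_0\ge 2$, then for each $\varepsilon\in\{1,-1\}$ there is a polynomial $P^\varepsilon\in\mathbf Z[t]$, depending only on $\varepsilon$ and $(r_0,r_2,r_4,\dots)$, such that for every finite field $\mathbf F_q$ (of any characteristic $p$) and every $r_0$-dimensional $\mathbf F_q$-vector space $\mathcal V$ with a nondegenerate quadratic form $u$ of type $\eta_u=\varepsilon$, the number $X(\mathcal V,u)$ is finite and equals $P^\varepsilon(q)$. -/

import Mathlib

namespace QuadChains

variable {k V : Type*} [Field k] [AddCommGroup V] [Module k V]

/-- A quadratic form `Q` is nondegenerate if its restriction to the radical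
`{x | ⟨x, V⟩ = 0}` of the associated bilinear form `⟨x, y⟩ = Q (x + y) - Q x - Q y`
is injective. (In characteristic two this radical may be a line.) -/
def IsNondegenerate (Q : QuadraticForm k V) : Prop :=
  Set.InjOn Q (LinearMap.ker Q.polarBilin : Set V)

/-- `Q` is zero on some subspace of half the dimension of `V`. -/
def HasLagrangian (Q : QuadraticForm k V) : Prop :=
  ∃ W : Submodule k V, 2 * Module.finrank k W = Module.finrank k V ∧ ∀ x ∈ W, Q x = 0

open Classical in
/-- The type of a quadratic form on a space of even dimension at least two:
`1` if it is zero on some subspace of half the dimension, and `-1` if not. -/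
noncomputable def formType (Q : QuadraticForm k V) : ℤˣ :=
  if HasLagrangian Q then 1 else -1

/-- The chains `U 0 ⊇ U 1 ⊇ U 2 ⊇ ⋯` of subspaces with `dim (U n) = r n` on each of which
the form `Q` is nondegenerate. -/
def chains (Q : QuadraticForm k V) (r : ℕ → ℕ) : Set (ℕ → Submodule k V) :=
  {U | Antitone U ∧ ∀ n, Module.finrank k (U n) = r n ∧ IsNondegenerate (Q.restrict (U n))}

end QuadChains

namespace QuadChains

open Module

/-! ### Singular radicals, and the passage from `x^⊥` to `x^⊥/x`. -/

section Linear

variable {k V : Type*} [Field k] [AddCommGroup V] [Module k V]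

/-! Every count is shown to have the form `C(q) + sgn Q * D(q)` with `C, D` integer polynomials
depending only on numerical data (`IsPoly`). Here `sgn` is the type in even dimension (with value
`1` in dimension `0`) and `0` in odd dimension. A chain amounts to its second member `A` and a chain
in `A`, so induction on the length reduces the theorem to two sums over the nondegenerate subspaces
`A` of fixed dimension: their number and the sum of their types.

Both come from counting all subspaces by the dimension `s` of their singular radical. If `x` is a
nonzero singular vector, the subspaces whose singular radical contains `x` are those between `x` and
`x^⊥`; they correspond to subspaces of `x^⊥/x`, a nondegenerate space of the same type and dimension
two less. Double counting pairs `(x, U)` settles `s > 0` by recursion (`radSum_rec`), and `s = 0`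
follows by subtraction from the total (`isPoly_radSum`). Weighting each subspace by its number of
zeros gives the types as well, because the zero count of a nondegenerate form is affine in its type
(`zeroCount_top`, `isPoly_typeSum`).

Double counting determines the counts only after division by a monic polynomial `M`. The quotients
are again integer polynomials (`IsPoly.div`): forms of every dimension and type exist over the prime
fields of odd order, so divisibility of values holds at infinitely many primes, which forces
divisibility in `ℤ[X]`. The result then applies to every `q`, including even ones. -/

theorem isNondegenerate_iff (Q : QuadraticForm k V) :
    IsNondegenerate Q ↔ ∀ x, Q x = 0 → (∀ y, QuadraticMap.polar Q x y = 0) → x = 0 := by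
  constructor
  · intro h x hx hp
    refine h (x₁ := x) (x₂ := 0) ?_ (Submodule.zero_mem _) (by simpa using hx)
    exact LinearMap.ext fun y => by simpa using hp y
  · intro h x hx y hy hxy
    have hx' : ∀ z, QuadraticMap.polar Q x z = 0 := fun z => by
      simpa using LinearMap.congr_fun (LinearMap.mem_ker.1 hx) z
    have hy' : ∀ z, QuadraticMap.polar Q y z = 0 := fun z => by
      simpa using LinearMap.congr_fun (LinearMap.mem_ker.1 hy) z
    -- On the radical `Q` is additive, so equal values at `x` and `y` make `x - y` singular.
    refine sub_eq_zero.1 (h (x - y) ?_ fun z => ?_)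
    · have h1 := QuadraticMap.map_add Q (x - y) y
      rw [sub_add_cancel, QuadraticMap.polar_comm, hy', add_zero, hxy] at h1
      simpa using h1
    · rw [QuadraticMap.polar_sub_left, hx', hy', sub_zero]

/-- The singular radical of the restriction of `Q` to `U`, as a subspace of `V`. -/
def singRad (Q : QuadraticForm k V) (U : Submodule k V) : Submodule k V where
  carrier := {x | x ∈ U ∧ Q x = 0 ∧ ∀ y ∈ U, QuadraticMap.polar Q x y = 0}
  zero_mem' := ⟨U.zero_mem, by simp, fun y _ => by simp⟩
  add_mem' := fun {a b} ha hb => ⟨U.add_mem ha.1 hb.1, by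
    rw [QuadraticMap.map_add Q, ha.2.1, hb.2.1, ha.2.2 b hb.1]; simp, fun y hy => by
    rw [QuadraticMap.polar_add_left, ha.2.2 y hy, hb.2.2 y hy, add_zero]⟩
  smul_mem' := fun c x hx => ⟨U.smul_mem c hx.1, by
    rw [QuadraticMap.map_smul, hx.2.1, smul_zero], fun y hy => by
    rw [QuadraticMap.polar_smul_left, hx.2.2 y hy, smul_zero]⟩

theorem mem_singRad {Q : QuadraticForm k V} {U : Submodule k V} {x : V} :
    x ∈ singRad Q U ↔ x ∈ U ∧ Q x = 0 ∧ ∀ y ∈ U, QuadraticMap.polar Q x y = 0 := Iff.rfl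

theorem singRad_le (Q : QuadraticForm k V) (U : Submodule k V) : singRad Q U ≤ U :=
  fun _ hx => hx.1

theorem isNondegenerate_restrict_iff (Q : QuadraticForm k V) (U : Submodule k V) :
    IsNondegenerate (Q.restrict U) ↔ singRad Q U = ⊥ := by
  rw [isNondegenerate_iff, Submodule.eq_bot_iff]
  constructor
  · intro h x hx
    exact congrArg Subtype.val (h ⟨x, hx.1⟩ hx.2.1 fun y => hx.2.2 y y.2)
  · intro h x hx hp
    exact Subtype.ext (h x ⟨x.2, hx, fun y hy => hp ⟨y, hy⟩⟩)

theorem map_singRad_restrict (Q : QuadraticForm k V) (A : Submodule k V) (U : Submodule k A) :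
    (singRad (Q.restrict A) U).map A.subtype = singRad Q (U.map A.subtype) := by
  ext x
  constructor
  · rintro ⟨x, hx, rfl⟩
    refine ⟨⟨x, hx.1, rfl⟩, hx.2.1, ?_⟩
    rintro _ ⟨y, hy, rfl⟩
    exact hx.2.2 y hy
  · rintro ⟨⟨x, hx, rfl⟩, h1, h2⟩
    exact ⟨x, ⟨hx, h1, fun y hy => h2 y ⟨y, hy, rfl⟩⟩, rfl⟩

theorem finrank_map_subtype' (A : Submodule k V) (U : Submodule k A) :
    finrank k (U.map A.subtype) = finrank k U :=
  LinearEquiv.finrank_eq (Submodule.equivSubtypeMap A U).symm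

theorem isNondegenerate_restrict_restrict_iff (Q : QuadraticForm k V) (A : Submodule k V)
    (U : Submodule k A) :
    IsNondegenerate ((Q.restrict A).restrict U) ↔
      IsNondegenerate (Q.restrict (U.map A.subtype)) := by
  rw [isNondegenerate_restrict_iff, isNondegenerate_restrict_iff, ← map_singRad_restrict,
    ← Submodule.map_bot A.subtype,
    (Submodule.map_injective_of_injective A.injective_subtype).eq_iff]

/-- `Q` vanishes on `W`. -/
def TotSing (Q : QuadraticForm k V) (W : Submodule k V) : Prop := ∀ x ∈ W, Q x = 0

theorem TotSing.polar {Q : QuadraticForm k V} {W : Submodule k V} (h : TotSing Q W) {x y : V}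
    (hx : x ∈ W) (hy : y ∈ W) : QuadraticMap.polar Q x y = 0 := by
  simp [QuadraticMap.polar, h _ hx, h _ hy, h _ (W.add_mem hx hy)]

theorem exists_submodule_le_finrank_eq [FiniteDimensional k V] (W : Submodule k V) {d : ℕ}
    (hd : d ≤ finrank k W) : ∃ W' ≤ W, finrank k W' = d := by
  obtain ⟨f, hf⟩ := exists_linearIndependent_of_le_finrank hd
  refine ⟨(Submodule.span k (Set.range f)).map W.subtype, Submodule.map_subtype_le _ _, ?_⟩
  rw [finrank_map_subtype', finrank_span_eq_card hf, Fintype.card_fin]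

theorem hasLagrangian_of_le [FiniteDimensional k V] {Q : QuadraticForm k V}
    (hV : Even (finrank k V)) {W : Submodule k V} (hW : TotSing Q W)
    (h : finrank k V ≤ 2 * finrank k W) : HasLagrangian Q := by
  obtain ⟨d, hd⟩ := hV
  obtain ⟨W', hW', hd'⟩ := exists_submodule_le_finrank_eq W (d := d) (by lia)
  exact ⟨W', by lia, fun x hx => hW x (hW' hx)⟩

/-- The hyperplane orthogonal to `x`. -/
def perp (Q : QuadraticForm k V) (x : V) : Submodule k V := LinearMap.ker (Q.polarBilin x)

theorem mem_perp {Q : QuadraticForm k V} {x y : V} :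
    y ∈ perp Q x ↔ QuadraticMap.polar Q x y = 0 := by
  simp [perp]

theorem mem_perp_self {Q : QuadraticForm k V} {x : V} (hx : Q x = 0) : x ∈ perp Q x := by
  rw [mem_perp, QuadraticMap.polar_self, hx, smul_zero]

/-- With `Y = perp Q x`, the complement is a model of `x^⊥/x` inside `V`, so the induced form is
just a restriction of `Q`. -/
theorem exists_compl_span (Y : Submodule k V) {x : V} (hx : x ∈ Y) :
    ∃ V' : Submodule k V, V' ⊔ k ∙ x = Y ∧ V' ⊓ k ∙ x = ⊥ := by
  obtain ⟨C, hC⟩ := Submodule.exists_isCompl (k ∙ x)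
  have hxY : k ∙ x ≤ Y := (Submodule.span_singleton_le_iff_mem _ _).2 hx
  refine ⟨C ⊓ Y, ?_, ?_⟩
  · rw [sup_comm, ← sup_inf_assoc_of_le _ hxY, hC.sup_eq_top, top_inf_eq]
  · rw [inf_right_comm, inf_comm C, hC.inf_eq_bot, bot_inf_eq]

section Compl

variable {Q : QuadraticForm k V} {x : V} {V' : Submodule k V}

theorem finrank_sup_span [FiniteDimensional k V] (hx0 : x ≠ 0) (hV : V' ⊓ k ∙ x = ⊥) {U : Submodule k V} (hU : U ≤ V') :
    finrank k ↥(U ⊔ k ∙ x) = finrank k U + 1 := by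
  have h := Submodule.finrank_sup_add_finrank_inf_eq U (k ∙ x)
  rwa [eq_bot_iff.2 ((inf_le_inf_right _ hU).trans hV.le), finrank_bot, finrank_span_singleton hx0,
    add_zero] at h

theorem sup_span_inf (hV : V' ⊓ k ∙ x = ⊥) {U : Submodule k V} (hU : U ≤ V') :
    (U ⊔ k ∙ x) ⊓ V' = U := by
  rw [sup_inf_assoc_of_le _ hU, inf_comm, hV, sup_bot_eq]

theorem inf_sup_span {Y : Submodule k V} (hY : V' ⊔ k ∙ x = Y) {U : Submodule k V} (hU : U ≤ Y)
    (hx : x ∈ U) : U ⊓ V' ⊔ k ∙ x = U := by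
  have hxU : k ∙ x ≤ U := (Submodule.span_singleton_le_iff_mem _ _).2 hx
  rw [inf_comm, sup_comm, ← sup_inf_assoc_of_le _ hxU, sup_comm, hY, inf_eq_right.2 hU]

theorem exists_polar_ne (hQ : IsNondegenerate Q) (hx0 : x ≠ 0) (hx : Q x = 0) :
    ∃ y, QuadraticMap.polar Q x y ≠ 0 := by
  by_contra! h
  exact hx0 ((isNondegenerate_iff Q).1 hQ x hx h)

theorem finrank_perp [FiniteDimensional k V] (hQ : IsNondegenerate Q) (hx0 : x ≠ 0) (hx : Q x = 0) :
    finrank k (perp Q x) + 1 = finrank k V := by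
  obtain ⟨y, hy⟩ := exists_polar_ne hQ hx0 hx
  refine Module.Dual.finrank_ker_add_one_of_ne_zero (f := Q.polarBilin x) fun h => hy ?_
  simpa using LinearMap.congr_fun h y

theorem finrank_compl [FiniteDimensional k V] (hQ : IsNondegenerate Q) (hx0 : x ≠ 0) (hx : Q x = 0)
    (hY : V' ⊔ k ∙ x = perp Q x) (hV : V' ⊓ k ∙ x = ⊥) :
    finrank k V' + 2 = finrank k V := by
  rw [← finrank_perp hQ hx0 hx, ← hY, finrank_sup_span hx0 hV le_rfl]

theorem map_add_smul (hx : Q x = 0) {u : V} (hu : u ∈ perp Q x) (t : k) :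
    Q (u + t • x) = Q u := by
  rw [QuadraticMap.map_add Q, QuadraticMap.map_smul, hx, QuadraticMap.polar_smul_right,
    QuadraticMap.polar_comm, mem_perp.1 hu]
  simp

theorem compl_le (hY : V' ⊔ k ∙ x = perp Q x) : V' ≤ perp Q x := hY ▸ le_sup_left

theorem mem_sup_span_iff {U : Submodule k V} {v : V} :
    v ∈ U ⊔ k ∙ x ↔ ∃ u ∈ U, ∃ t : k, u + t • x = v := by
  simp [Submodule.mem_sup, Submodule.mem_span_singleton]

/-- On `x^⊥` neither `Q` nor its polar form changes when multiples of `x` are added. -/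
theorem singRad_sup_span (hx : Q x = 0) (hY : V' ⊔ k ∙ x = perp Q x)
    {U : Submodule k V} (hU : U ≤ V') :
    singRad Q (U ⊔ k ∙ x) = singRad Q U ⊔ k ∙ x := by
  have hUp : U ≤ perp Q x := hU.trans (compl_le hY)
  have hpol : ∀ u ∈ U, ∀ t : k, ∀ w (s : k), w ∈ U →
      QuadraticMap.polar Q (u + t • x) (w + s • x) = QuadraticMap.polar Q u w := by
    intro u hu t w s hw
    have h1 := mem_perp.1 (hUp hu)
    have h2 := mem_perp.1 (hUp hw)
    have h3 := mem_perp.1 (mem_perp_self hx)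
    simp [QuadraticMap.polar_add_left, QuadraticMap.polar_add_right, QuadraticMap.polar_smul_left,
      QuadraticMap.polar_smul_right, h2, h3, QuadraticMap.polar_comm Q u x, h1]
  ext v
  constructor
  · rintro ⟨hv, hv0, hvp⟩
    obtain ⟨u, hu, t, rfl⟩ := mem_sup_span_iff.1 hv
    rw [mem_sup_span_iff]
    refine ⟨u, ⟨hu, by rwa [map_add_smul hx (hUp hu)] at hv0, fun w hw => ?_⟩, t, rfl⟩
    rw [← hpol u hu t w 0 hw]
    exact hvp _ (mem_sup_span_iff.2 ⟨w, hw, 0, rfl⟩)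
  · intro hv
    obtain ⟨u, hu, t, rfl⟩ := mem_sup_span_iff.1 hv
    refine ⟨mem_sup_span_iff.2 ⟨u, hu.1, t, rfl⟩, by rw [map_add_smul hx (hUp hu.1), hu.2.1], ?_⟩
    intro w hw
    obtain ⟨w, hw', s, rfl⟩ := mem_sup_span_iff.1 hw
    rw [hpol u hu.1 t w s hw', hu.2.2 w hw']

/-- A vector `v` of the singular radical of `V'` is orthogonal to all of `x^⊥`, so its polar
functional is a multiple `c` of that of `x`. Then `v - c • x` lies in the singular radical of `Q`
and vanishes, which puts `v` in `V' ⊓ k ∙ x`. -/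
theorem isNondegenerate_compl (hQ : IsNondegenerate Q) (hx0 : x ≠ 0) (hx : Q x = 0)
    (hY : V' ⊔ k ∙ x = perp Q x) (hV : V' ⊓ k ∙ x = ⊥) : IsNondegenerate (Q.restrict V') := by
  rw [isNondegenerate_restrict_iff, Submodule.eq_bot_iff]
  rintro v ⟨hv, hv0, hvp⟩
  obtain ⟨y, hy⟩ := exists_polar_ne hQ hx0 hx
  have hvx := mem_perp.1 (compl_le hY hv)
  have hvY : ∀ w ∈ perp Q x, QuadraticMap.polar Q v w = 0 := by
    intro w hw
    rw [← hY, mem_sup_span_iff] at hw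
    obtain ⟨u, hu, t, rfl⟩ := hw
    rw [QuadraticMap.polar_add_right, hvp u hu, QuadraticMap.polar_smul_right,
      QuadraticMap.polar_comm, hvx]
    simp
  set c := QuadraticMap.polar Q v y / QuadraticMap.polar Q x y with hc
  have hrad : v - c • x = 0 := by
    refine (isNondegenerate_iff Q).1 hQ _ ?_ fun w => ?_
    · rw [sub_eq_add_neg, ← neg_smul, map_add_smul hx (compl_le hY hv), hv0]
    · have hw : w - (QuadraticMap.polar Q x w / QuadraticMap.polar Q x y) • y ∈ perp Q x := by
        rw [mem_perp, QuadraticMap.polar_sub_right, QuadraticMap.polar_smul_right, smul_eq_mul,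
          div_mul_cancel₀ _ hy, sub_self]
      have h1 := hvY _ hw
      rw [QuadraticMap.polar_sub_right, QuadraticMap.polar_smul_right, smul_eq_mul,
        sub_eq_zero] at h1
      rw [QuadraticMap.polar_sub_left, QuadraticMap.polar_smul_left, h1, hc, smul_eq_mul]
      ring
  have : v ∈ V' ⊓ k ∙ x :=
    ⟨hv, Submodule.mem_span_singleton.2 ⟨c, (sub_eq_zero.1 hrad).symm⟩⟩
  rwa [hV, Submodule.mem_bot] at this

theorem totSing_sup_span (hx : Q x = 0) {U : Submodule k V} (hU : U ≤ perp Q x)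
    (h : TotSing Q U) : TotSing Q (U ⊔ k ∙ x) := by
  intro v hv
  obtain ⟨u, hu, t, rfl⟩ := mem_sup_span_iff.1 hv
  rw [map_add_smul hx (hU hu), h u hu]

/-- Adjoining `x` lifts a Lagrangian of `V'`. Conversely a Lagrangian `L` is replaced by `(L ∩ x^⊥)
+ x`, which is no smaller and contains `x`, and is then cut down to `V'`. -/
theorem hasLagrangian_compl_iff [FiniteDimensional k V] (hQ : IsNondegenerate Q) (hx0 : x ≠ 0) (hx : Q x = 0)
    (hY : V' ⊔ k ∙ x = perp Q x) (hV : V' ⊓ k ∙ x = ⊥) (heven : Even (finrank k V)) :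
    HasLagrangian (Q.restrict V') ↔ HasLagrangian Q := by
  have hdim := finrank_compl hQ hx0 hx hY hV
  constructor
  · rintro ⟨L, hL, hL0⟩
    have hLV : L.map V'.subtype ≤ V' := Submodule.map_subtype_le _ _
    refine ⟨L.map V'.subtype ⊔ k ∙ x, ?_, ?_⟩
    · rw [finrank_sup_span hx0 hV hLV, finrank_map_subtype']
      lia
    · refine totSing_sup_span hx (hLV.trans (compl_le hY)) ?_
      rintro _ ⟨y, hy, rfl⟩
      exact hL0 y hy
  · rintro ⟨L, hL, hL0⟩
    have hT : TotSing Q (L ⊓ perp Q x ⊔ k ∙ x) :=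
      totSing_sup_span hx inf_le_right fun y hy => hL0 y hy.1
    have hxM : x ∈ L ⊓ perp Q x ⊔ k ∙ x := mem_sup_span_iff.2 ⟨0, zero_mem _, 1, by simp⟩
    have hMY : L ⊓ perp Q x ⊔ k ∙ x ≤ perp Q x :=
      sup_le inf_le_right ((Submodule.span_singleton_le_iff_mem _ _).2 (mem_perp_self hx))
    -- If `x ∈ L`, then `L` already lies in `x^⊥`; otherwise at most one dimension is lost to the
    -- hyperplane and `x` restores it.
    have hd : finrank k L ≤ finrank k ↥(L ⊓ perp Q x ⊔ k ∙ x) := by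
      by_cases hxL : x ∈ L
      · refine Submodule.finrank_mono (le_sup_of_le_left (le_inf le_rfl fun y hy => ?_))
        exact mem_perp.2 (TotSing.polar hL0 hxL hy)
      · have h1 : (L ⊓ perp Q x) ⊓ k ∙ x = ⊥ := by
          rw [Submodule.eq_bot_iff]
          rintro y ⟨hy, hy'⟩
          obtain ⟨t, rfl⟩ := Submodule.mem_span_singleton.1 hy'
          by_contra hne
          refine hxL ((Submodule.smul_mem_iff _ fun ht => hne ?_).1 hy.1)
          rw [ht, zero_smul]
        rw [finrank_sup_span hx0 h1 le_rfl]
        have h2 := Submodule.finrank_sup_add_finrank_inf_eq L (perp Q x)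
        have h3 := finrank_perp hQ hx0 hx
        have h4 := Submodule.finrank_le (L ⊔ perp Q x)
        lia
    set M := L ⊓ perp Q x ⊔ k ∙ x
    have hM := finrank_sup_span hx0 hV (U := M ⊓ V') inf_le_right
    rw [inf_sup_span hY hMY hxM] at hM
    refine hasLagrangian_of_le (W := (M ⊓ V').comap V'.subtype) ?_ (fun y hy => hT _ hy.1) ?_
    · rw [← hdim] at heven
      exact (Nat.even_add.1 heven).2 even_two
    · rw [← finrank_map_subtype', Submodule.map_comap_subtype, inf_comm V', inf_assoc, inf_idem]
      lia

end Compl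

/-- The type of `Q`, with value `0` on spaces of odd dimension. -/
noncomputable def sgn (Q : QuadraticForm k V) : ℤ :=
  open Classical in if Even (finrank k V) then (formType Q : ℤ) else 0

theorem sgn_odd {Q : QuadraticForm k V} (h : ¬ Even (finrank k V)) : sgn Q = 0 := if_neg h

theorem sgn_even {Q : QuadraticForm k V} (h : Even (finrank k V)) : sgn Q = formType Q := if_pos h

theorem formType_congr {W : Type*} [AddCommGroup W] [Module k W] {Q : QuadraticForm k V}
    {R : QuadraticForm k W} (h : HasLagrangian Q ↔ HasLagrangian R) :
    formType Q = formType R := by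
  by_cases hR : HasLagrangian R
  · rw [formType, formType, if_pos hR, if_pos (h.2 hR)]
  · rw [formType, formType, if_neg hR, if_neg fun h' => hR (h.1 h')]

theorem sgn_compl [FiniteDimensional k V] {Q : QuadraticForm k V} {x : V} {V' : Submodule k V}
    (hQ : IsNondegenerate Q) (hx0 : x ≠ 0) (hx : Q x = 0)
    (hY : V' ⊔ k ∙ x = perp Q x) (hV : V' ⊓ k ∙ x = ⊥) : sgn (Q.restrict V') = sgn Q := by
  have hdim := finrank_compl hQ hx0 hx hY hV
  by_cases h : Even (finrank k V)
  · have h' : Even (finrank k V') := by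
      rw [← hdim] at h
      exact (Nat.even_add.1 h).2 even_two
    rw [sgn_even h, sgn_even h', formType_congr (hasLagrangian_compl_iff hQ hx0 hx hY hV h)]
  · have h' : ¬ Even (finrank k V') := by
      rw [← hdim] at h
      exact fun h' => h (h'.add even_two)
    rw [sgn_odd h, sgn_odd h']

end Linear

/-! ### The number of zeros of a nondegenerate form. -/

section Zeros

variable {k V : Type*} [Field k] [AddCommGroup V] [Module k V]

/-- The number of zeros of `Q` on `U`. -/
noncomputable def zeroCount (Q : QuadraticForm k V) (U : Submodule k V) : ℕ :=
  Nat.card {x : V // x ∈ U ∧ Q x = 0}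

theorem add_smul_inj {V' : Submodule k V} {x : V} (hx0 : x ≠ 0) (hV : V' ⊓ k ∙ x = ⊥)
    {u u' : V} (hu : u ∈ V') (hu' : u' ∈ V') {t t' : k} (h : u + t • x = u' + t' • x) :
    u = u' ∧ t = t' := by
  have h1 : u - u' = (t' - t) • x := by
    rw [sub_smul, sub_eq_sub_iff_add_eq_add, h, add_comm]
  have h2 : u - u' ∈ V' ⊓ k ∙ x :=
    ⟨V'.sub_mem hu hu', Submodule.mem_span_singleton.2 ⟨_, h1.symm⟩⟩
  rw [hV, Submodule.mem_bot] at h2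
  rw [h2] at h1
  refine ⟨sub_eq_zero.1 h2, ?_⟩
  rcases smul_eq_zero.1 h1.symm with h3 | h3
  · exact (sub_eq_zero.1 h3).symm
  · exact absurd h3 hx0

theorem zeroCount_sup_span {Q : QuadraticForm k V} {x : V} {V' : Submodule k V}
    (hx0 : x ≠ 0) (hx : Q x = 0) (hY : V' ⊔ k ∙ x = perp Q x) (hV : V' ⊓ k ∙ x = ⊥)
    {U : Submodule k V} (hU : U ≤ V') :
    zeroCount Q (U ⊔ k ∙ x) = Nat.card k * zeroCount Q U := by
  have hUp : U ≤ perp Q x := hU.trans (compl_le hY)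
  rw [mul_comm, zeroCount, zeroCount, ← Nat.card_prod]
  symm
  refine Nat.card_congr (Equiv.ofBijective
    (fun p => ⟨p.1.1 + p.2 • x, mem_sup_span_iff.2 ⟨p.1.1, p.1.2.1, p.2, rfl⟩, by
      rw [map_add_smul hx (hUp p.1.2.1), p.1.2.2]⟩) ⟨?_, ?_⟩)
  · rintro ⟨⟨u, hu, hu0⟩, t⟩ ⟨⟨u', hu', hu0'⟩, t'⟩ h
    obtain ⟨rfl, rfl⟩ := add_smul_inj hx0 hV (hU hu) (hU hu') (congrArg Subtype.val h)
    rfl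
  · rintro ⟨v, hv, hv0⟩
    obtain ⟨u, hu, t, rfl⟩ := mem_sup_span_iff.1 hv
    exact ⟨⟨⟨u, hu, by rwa [map_add_smul hx (hUp hu)] at hv0⟩, t⟩, rfl⟩

theorem zeroCount_restrict (Q : QuadraticForm k V) (A : Submodule k V) (U : Submodule k A) :
    zeroCount (Q.restrict A) U = zeroCount Q (U.map A.subtype) := by
  refine Nat.card_congr (Equiv.ofBijective
    (fun x => ⟨x.1.1, ⟨x.1, x.2.1, rfl⟩, x.2.2⟩) ⟨?_, ?_⟩)
  · intro a b h
    have h1 : a.1.1 = b.1.1 := Subtype.mk.inj h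
    exact Subtype.ext (Subtype.ext h1)
  · rintro ⟨_, ⟨y, hy, rfl⟩, h⟩
    exact ⟨⟨y, hy, h⟩, rfl⟩

theorem zeroCount_restrict_top (Q : QuadraticForm k V) (A : Submodule k V) :
    zeroCount (Q.restrict A) ⊤ = zeroCount Q A := by
  rw [zeroCount_restrict, Submodule.map_subtype_top]

/-- Each line in the direction of a singular vector `x` which is not orthogonal to `x` contains
exactly one zero of `Q`. -/
theorem card_zero_not_mem_perp {Q : QuadraticForm k V} {x : V} (hx : Q x = 0) :
    Nat.card {v : V // v ∉ perp Q x ∧ Q v = 0} * Nat.card k = Nat.card {v : V // v ∉ perp Q x} := by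
  have hxx := mem_perp.1 (mem_perp_self hx)
  have hp : ∀ v, ∀ t : k, QuadraticMap.polar Q x (v + t • x) = QuadraticMap.polar Q x v := by
    intro v t
    rw [QuadraticMap.polar_add_right, QuadraticMap.polar_smul_right, hxx]
    simp
  have hq : ∀ v, ∀ t : k, Q (v + t • x) = Q v + t * QuadraticMap.polar Q x v := by
    intro v t
    rw [QuadraticMap.map_add Q, QuadraticMap.map_smul, hx, QuadraticMap.polar_smul_right,
      QuadraticMap.polar_comm]
    simp
  rw [← Nat.card_prod]
  refine Nat.card_congr (Equiv.ofBijective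
    (fun p => ⟨p.1.1 + p.2 • x, by rw [mem_perp, hp, ← mem_perp]; exact p.1.2.1⟩) ⟨?_, ?_⟩)
  · rintro ⟨⟨u, hu, hu0⟩, t⟩ ⟨⟨u', hu', hu0'⟩, t'⟩ h
    have h1 : u + t • x = u' + t' • x := congrArg Subtype.val h
    have h2 : u' = u + (t - t') • x := by
      rw [sub_smul, ← add_sub_assoc, h1, add_sub_cancel_right]
    rw [h2, hq, hu0, zero_add, mul_eq_zero, sub_eq_zero] at hu0'
    rcases hu0' with rfl | h3
    · rw [sub_self, zero_smul, add_zero] at h2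
      subst h2
      rfl
    · exact absurd (mem_perp.2 h3) hu
  · rintro ⟨w, hw⟩
    have hw' : QuadraticMap.polar Q x w ≠ 0 := fun h => hw (mem_perp.2 h)
    refine ⟨⟨⟨w + (-(Q w / QuadraticMap.polar Q x w)) • x, ?_, ?_⟩,
      Q w / QuadraticMap.polar Q x w⟩, ?_⟩
    · rwa [mem_perp, hp, ← mem_perp]
    · rw [hq, neg_mul, div_mul_cancel₀ _ hw', add_neg_cancel]
    · apply Subtype.ext
      simp

theorem finrank_perp_ge [FiniteDimensional k V] (Q : QuadraticForm k V) (x : V) :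
    finrank k V ≤ finrank k (perp Q x) + 1 := by
  rw [← LinearMap.finrank_range_add_finrank_ker (Q.polarBilin x), add_comm]
  exact Nat.add_le_add_left ((Submodule.finrank_le _).trans (finrank_self k).le) _

theorem not_hasLagrangian_of_anisotropic {Q : QuadraticForm k V} (ha : ∀ x, Q x = 0 → x = 0)
    (hV : 0 < finrank k V) : ¬ HasLagrangian Q := by
  rintro ⟨W, hW, hW0⟩
  have : W = ⊥ := (Submodule.eq_bot_iff W).2 fun y hy => ha y (hW0 y hy)
  rw [this, finrank_bot] at hW
  lia

theorem sgn_eq_one_of_finrank_eq_zero {Q : QuadraticForm k V} (h : finrank k V = 0) :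
    sgn Q = 1 := by
  have : HasLagrangian Q := ⟨⊥, by simp [h], by simp⟩
  rw [sgn_even (by simp [h]), formType, if_pos this]
  rfl

theorem sgn_eq_neg_one_of_anisotropic {Q : QuadraticForm k V} (ha : ∀ x, Q x = 0 → x = 0)
    (h : finrank k V = 2) : sgn Q = -1 := by
  rw [sgn_even (by simp [h]), formType,
    if_neg (not_hasLagrangian_of_anisotropic ha (by lia))]
  rfl

variable [Finite k] [FiniteDimensional k V]

theorem card_not_mem_add (Y : Submodule k V) :
    Nat.card {v : V // v ∉ Y} + Nat.card k ^ finrank k Y = Nat.card k ^ finrank k V := by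
  classical
  have : Finite V := Module.finite_of_finite k
  rw [← natCard_eq_pow_finrank (K := k) (V := V), ← natCard_eq_pow_finrank (K := k) (V := Y),
    Nat.card_congr (Equiv.sumCompl (· ∈ Y)).symm, Nat.card_sum, add_comm]

/-- Inside `x^⊥` each zero in `V'` accounts for `q` zeros; outside, one point in `q` is a zero. -/
theorem zeroCount_top_rec {Q : QuadraticForm k V} {x : V} {V' : Submodule k V}
    (hQ : IsNondegenerate Q) (hx0 : x ≠ 0) (hx : Q x = 0)
    (hY : V' ⊔ k ∙ x = perp Q x) (hV : V' ⊓ k ∙ x = ⊥) :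
    Nat.card k * zeroCount Q ⊤ + Nat.card k ^ (finrank k V' + 1) =
      Nat.card k * (Nat.card k * zeroCount Q V') + Nat.card k ^ (finrank k V' + 2) := by
  classical
  have : Finite V := Module.finite_of_finite k
  have h1 : zeroCount Q ⊤ = zeroCount Q (perp Q x) +
      Nat.card {v : V // v ∉ perp Q x ∧ Q v = 0} := by
    rw [zeroCount, zeroCount, ← Nat.card_sum]
    refine Nat.card_congr ((Equiv.sumCompl fun v : {v : V // v ∈ (⊤ : Submodule k V) ∧ Q v = 0} =>
      v.1 ∈ perp Q x).symm.trans (Equiv.sumCongr ?_ ?_))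
    · exact ⟨fun v => ⟨v.1.1, v.2, v.1.2.2⟩, fun v => ⟨⟨v.1, trivial, v.2.2⟩, v.2.1⟩,
        fun _ => rfl, fun _ => rfl⟩
    · exact ⟨fun v => ⟨v.1.1, v.2, v.1.2.2⟩, fun v => ⟨⟨v.1, trivial, v.2.2⟩, v.2.1⟩,
        fun _ => rfl, fun _ => rfl⟩
  have h2 := card_zero_not_mem_perp hx
  have h3 := card_not_mem_add (perp Q x)
  have h4 := finrank_perp hQ hx0 hx
  have h5 := finrank_compl hQ hx0 hx hY hV
  have h6 : finrank k (perp Q x) = finrank k V' + 1 := by lia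
  rw [h6, ← h2, ← h5] at h3
  rw [h1, ← hY, zeroCount_sup_span hx0 hx hY hV le_rfl, hY, ← h3]
  ring

/-- In characteristic two every scalar is a square, so two independent orthogonal vectors combine to
a singular one. In odd characteristic three nonzero mutually orthogonal vectors do, since `a² Q x +
b² Q y = -Q z` is solvable. -/
theorem finrank_le_two_of_anisotropic {Q : QuadraticForm k V} (h : ∀ x, Q x = 0 → x = 0) :
    finrank k V ≤ 2 := by
  by_contra! hn
  have : Nontrivial V := nontrivial_of_finrank_pos (R := k) (by lia)
  obtain ⟨x, hx⟩ := exists_ne (0 : V)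
  have hpx := finrank_perp_ge Q x
  have hQx : Q x ≠ 0 := fun h0 => hx (h x h0)
  by_cases hc : ringChar k = 2
  · obtain ⟨y, hy, hyx⟩ : ∃ y ∈ perp Q x, y ∉ k ∙ x := by
      by_contra! hle
      have := Submodule.finrank_mono (show perp Q x ≤ k ∙ x from hle)
      rw [finrank_span_singleton hx] at this
      lia
    have hy0 : y ≠ 0 := fun h0 => hyx (h0 ▸ zero_mem _)
    have hQy : Q y ≠ 0 := fun h0 => hy0 (h y h0)
    obtain ⟨c, hc'⟩ := FiniteField.isSquare_of_char_two hc (Q y / Q x)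
    have h0 : Q (y + c • x) = 0 := by
      rw [QuadraticMap.map_add Q, QuadraticMap.map_smul, QuadraticMap.polar_smul_right,
        QuadraticMap.polar_comm, mem_perp.1 hy, ← hc', smul_eq_mul, div_mul_cancel₀ _ hQx,
        smul_zero, add_zero, ← two_mul]
      have : CharP k 2 := hc ▸ ringChar.charP k
      rw [CharTwo.two_eq_zero, zero_mul]
    refine hyx (Submodule.mem_span_singleton.2 ⟨-c, ?_⟩)
    rw [neg_smul, neg_eq_iff_add_eq_zero, add_comm]
    exact h _ h0
  · have hex : ∀ Y : Submodule k V, 0 < finrank k Y → ∃ y ∈ Y, y ≠ 0 := by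
      intro Y hY
      by_contra! hle
      rw [(Submodule.eq_bot_iff Y).2 hle, finrank_bot] at hY
      exact lt_irrefl _ hY
    obtain ⟨y, hy, hy0⟩ := hex (perp Q x) (by lia)
    have hpy := finrank_perp_ge Q y
    obtain ⟨z, hz, hz0⟩ := hex (perp Q x ⊓ perp Q y) (by
      have h1 := Submodule.finrank_sup_add_finrank_inf_eq (perp Q x) (perp Q y)
      have h2 := Submodule.finrank_le (perp Q x ⊔ perp Q y)
      lia)
    have hQy : Q y ≠ 0 := fun h0 => hy0 (h y h0)
    have hQz : Q z ≠ 0 := fun h0 => hz0 (h z h0)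
    have := Fintype.ofFinite k
    -- The zero linear coefficients match the shape required by `Polynomial.degree_quadratic`.
    obtain ⟨a, b, hab⟩ := FiniteField.exists_root_sum_quadratic
      (f := Polynomial.C (Q x) * Polynomial.X ^ 2 + Polynomial.C 0 * Polynomial.X +
        Polynomial.C (Q z))
      (g := Polynomial.C (Q y) * Polynomial.X ^ 2 + Polynomial.C 0 * Polynomial.X +
        Polynomial.C 0)
      (Polynomial.degree_quadratic hQx) (Polynomial.degree_quadratic hQy)
      (FiniteField.odd_card_of_char_ne_two hc)
    simp only [map_zero, zero_mul, add_zero, Polynomial.eval_add, Polynomial.eval_mul,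
      Polynomial.eval_C, Polynomial.eval_pow, Polynomial.eval_X] at hab
    have hxy := mem_perp.1 hy
    have hxz := mem_perp.1 hz.1
    have hyz := mem_perp.1 hz.2
    have h0 : Q (a • x + b • y + z) = 0 := by
      rw [QuadraticMap.map_add Q, QuadraticMap.map_add Q (a • x), QuadraticMap.map_smul,
        QuadraticMap.map_smul, QuadraticMap.polar_add_left]
      simp only [QuadraticMap.polar_smul_left, QuadraticMap.polar_smul_right, hxy, hxz, hyz,
        smul_eq_mul]
      linear_combination hab
    -- Linear independence is not needed: pairing the vanishing combination with `z` leaves `2 * Q z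
    -- = 0`.
    have h1 := congrArg (QuadraticMap.polar Q · z) (h _ h0)
    simp only [QuadraticMap.polar_add_left, QuadraticMap.polar_smul_left, hxz, hyz, smul_zero,
      zero_add, QuadraticMap.polar_self, QuadraticMap.polar_zero_left] at h1
    rw [two_nsmul, ← two_mul] at h1
    exact Ring.two_ne_zero hc ((mul_eq_zero.1 h1).resolve_right hQz)

/-- Induction through `x^⊥/x`, which preserves `sgn`, down to anisotropic forms. These have
dimension at most two, a single zero, and `sgn` equal to `1, 0, -1` in dimensions `0, 1, 2`. -/
theorem zeroCount_top (Q : QuadraticForm k V) (hQ : IsNondegenerate Q) :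
    (Nat.card k : ℤ) * zeroCount Q ⊤ =
      Nat.card k ^ finrank k V + sgn Q * ((Nat.card k - 1) * Nat.card k ^ (finrank k V / 2)) := by
  induction hn : finrank k V using Nat.strong_induction_on generalizing V with
  | _ n ih =>
  by_cases h : ∃ x, x ≠ 0 ∧ Q x = 0
  · obtain ⟨x, hx0, hx⟩ := h
    obtain ⟨V', hY, hV⟩ := exists_compl_span (perp Q x) (mem_perp_self hx)
    have hd := finrank_compl hQ hx0 hx hY hV
    have h1 := ih (finrank k V') (by lia) (Q.restrict V') (isNondegenerate_compl hQ hx0 hx hY hV) rfl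
    rw [sgn_compl hQ hx0 hx hY hV, zeroCount_restrict_top] at h1
    have h2 := zeroCount_top_rec hQ hx0 hx hY hV
    zify at h2
    rw [h1] at h2
    rw [← hn, ← hd, Nat.add_div_right _ two_pos]
    linear_combination h2
  · have ha : ∀ x, Q x = 0 → x = 0 := fun x hx => by
      by_contra h0
      exact h ⟨x, h0, hx⟩
    have hz : zeroCount Q ⊤ = 1 := by
      rw [zeroCount, Nat.card_eq_one_iff_unique]
      refine ⟨⟨fun a b => Subtype.ext ?_⟩, ⟨⟨0, trivial, by simp⟩⟩⟩
      rw [ha _ a.2.2, ha _ b.2.2]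
    have h2 := finrank_le_two_of_anisotropic ha
    rw [hz]
    rw [hn] at h2
    interval_cases n
    · rw [sgn_eq_one_of_finrank_eq_zero hn]
      simp
    · rw [sgn_odd (by simp [hn])]
      simp
    · rw [sgn_eq_neg_one_of_anisotropic ha hn]
      simp
      ring

end Zeros

open Polynomial

universe u v

/-! ### Forms of every dimension and type over prime fields of odd order. -/

section Existence

theorem hasLagrangian_of_equiv {k V W : Type*} [Field k] [AddCommGroup V] [Module k V]
    [AddCommGroup W] [Module k W] {Q : QuadraticForm k V} {R : QuadraticForm k W}
    (e : V ≃ₗ[k] W) (h : ∀ v, R (e v) = Q v) (hQ : HasLagrangian Q) : HasLagrangian R := by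
  obtain ⟨L, hL, hL0⟩ := hQ
  refine ⟨L.map (e : V →ₗ[k] W), ?_, ?_⟩
  · rw [LinearEquiv.finrank_map_eq, hL, e.finrank_eq]
  · rintro _ ⟨x, hx, rfl⟩
    exact (h x).trans (hL0 x hx)

theorem sgn_equiv {k V W : Type*} [Field k] [AddCommGroup V] [Module k V]
    [AddCommGroup W] [Module k W] {Q : QuadraticForm k V} {R : QuadraticForm k W}
    (e : V ≃ₗ[k] W) (h : ∀ v, R (e v) = Q v) : sgn Q = sgn R := by
  have hi : HasLagrangian Q ↔ HasLagrangian R :=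
    ⟨hasLagrangian_of_equiv e h, hasLagrangian_of_equiv e.symm fun w => by
      rw [← h, e.apply_symm_apply]⟩
  by_cases hV : Even (finrank k V)
  · rw [sgn_even hV, sgn_even (e.finrank_eq ▸ hV), formType_congr hi]
  · rw [sgn_odd hV, sgn_odd (e.finrank_eq ▸ hV)]

theorem isNondegenerate_of_equiv {k V W : Type*} [Field k] [AddCommGroup V] [Module k V]
    [AddCommGroup W] [Module k W] {Q : QuadraticForm k V} {R : QuadraticForm k W}
    (e : V ≃ₗ[k] W) (h : ∀ v, R (e v) = Q v) (hQ : IsNondegenerate Q) : IsNondegenerate R := by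
  rw [isNondegenerate_iff] at hQ ⊢
  intro x hx hp
  refine e.symm.map_eq_zero_iff.1 (hQ _ (by rw [← h, e.apply_symm_apply, hx]) fun y => ?_)
  rw [← hp (e y)]
  simp [QuadraticMap.polar, ← h]

theorem isNondegenerate_of_anisotropic {k V : Type*} [Field k] [AddCommGroup V] [Module k V]
    {Q : QuadraticForm k V} (h : ∀ x, Q x = 0 → x = 0) : IsNondegenerate Q :=
  (isNondegenerate_iff Q).2 fun x hx _ => h x hx

/-- The hyperbolic plane. -/
def hyperbolic (k : Type*) [Field k] : QuadraticForm k (k × k) :=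
  QuadraticMap.linMulLin (LinearMap.fst k k k) (LinearMap.snd k k k)

section Hyperbolic

variable {k V : Type*} [Field k] [AddCommGroup V] [Module k V]

theorem prod_hyperbolic_apply (Q : QuadraticForm k V) (x : V × k × k) :
    Q.prod (hyperbolic k) x = Q x.1 + x.2.1 * x.2.2 := by
  rw [QuadraticMap.prod_apply, hyperbolic, QuadraticMap.linMulLin_apply]
  rfl

theorem polar_prod_hyperbolic (Q : QuadraticForm k V) (x y : V × k × k) :
    QuadraticMap.polar (Q.prod (hyperbolic k)) x y =
      QuadraticMap.polar Q x.1 y.1 + (x.2.1 * y.2.2 + x.2.2 * y.2.1) := by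
  simp only [QuadraticMap.polar, prod_hyperbolic_apply, Prod.fst_add, Prod.snd_add]
  ring

theorem isNondegenerate_prod_hyperbolic {Q : QuadraticForm k V} (hQ : IsNondegenerate Q) :
    IsNondegenerate (Q.prod (hyperbolic k)) := by
  rw [isNondegenerate_iff] at hQ ⊢
  rintro ⟨v, a, b⟩ hx hp
  simp only [polar_prod_hyperbolic] at hp
  have hb : b = 0 := by simpa using hp (0, 1, 0)
  have ha : a = 0 := by simpa using hp (0, 0, 1)
  subst ha hb
  have hv : v = 0 := hQ v (by rwa [prod_hyperbolic_apply, zero_mul, add_zero] at hx) fun y => by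
    simpa using hp (y, 0, 0)
  rw [hv]
  rfl

/-- For the singular vector `x = (0, 1, 0)`, the copy of `V` is a complement of `x` in `x^⊥`, so
`sgn_compl` applies. -/
theorem sgn_prod_hyperbolic [FiniteDimensional k V] {Q : QuadraticForm k V}
    (hQ : IsNondegenerate Q) : sgn (Q.prod (hyperbolic k)) = sgn Q := by
  set R := Q.prod (hyperbolic k)
  have hx0 : ((0, 1, 0) : V × k × k) ≠ 0 := by simp
  have hx : R (0, 1, 0) = 0 := by rw [prod_hyperbolic_apply]; simp
  have hY : LinearMap.range (LinearMap.inl k V (k × k)) ⊔ k ∙ ((0, 1, 0) : V × k × k) =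
      perp R (0, 1, 0) := by
    ext ⟨v, a, b⟩
    rw [mem_sup_span_iff, mem_perp, polar_prod_hyperbolic]
    constructor
    · rintro ⟨_, ⟨w, rfl⟩, t, h⟩
      have hb := congrArg (fun z => z.2.2) h
      simp at hb
      simp [← hb]
    · intro h
      have hb : b = 0 := by simpa using h
      exact ⟨_, ⟨v, rfl⟩, a, by simp [hb]⟩
  have hV : LinearMap.range (LinearMap.inl k V (k × k)) ⊓ k ∙ ((0, 1, 0) : V × k × k) = ⊥ := by
    rw [Submodule.eq_bot_iff]
    rintro _ ⟨⟨w, rfl⟩, h⟩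
    obtain ⟨t, h⟩ := Submodule.mem_span_singleton.1 h
    have : 0 = w := by simpa using congrArg Prod.fst h
    simp [← this]
  rw [← sgn_compl (isNondegenerate_prod_hyperbolic hQ) hx0 hx hY hV]
  refine (sgn_equiv (LinearEquiv.ofInjective (LinearMap.inl k V (k × k)) LinearMap.inl_injective)
    fun v => ?_).symm
  rw [QuadraticMap.restrict_apply, LinearEquiv.ofInjective_apply, prod_hyperbolic_apply]
  simp

end Hyperbolic

/-- The pairs (dimension, value of `sgn`) of nondegenerate forms. -/
def Admissible (n : ℕ) (ε : ℤ) : Prop :=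
  (Odd n ∧ ε = 0) ∨ (n = 0 ∧ ε = 1) ∨ (Even n ∧ 0 < n ∧ (ε = 1 ∨ ε = -1))

theorem exists_admissible (n : ℕ) : ∃ ε, Admissible n ε := by
  by_cases h : Even n
  · rcases Nat.eq_zero_or_pos n with h0 | h0
    · exact ⟨1, Or.inr (Or.inl ⟨h0, rfl⟩)⟩
    · exact ⟨1, Or.inr (Or.inr ⟨h, h0, Or.inl rfl⟩)⟩
  · exact ⟨0, Or.inl ⟨Nat.not_even_iff_odd.1 h, rfl⟩⟩

theorem exists_form (k : Type u) [Field k] [Finite k] (hk : ringChar k ≠ 2) (n : ℕ) (ε : ℤ)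
    (h : Admissible n ε) :
    ∃ (V : Type u) (_ : AddCommGroup V) (_ : Module k V) (_ : FiniteDimensional k V)
      (Q : QuadraticForm k V), finrank k V = n ∧ IsNondegenerate Q ∧ sgn Q = ε := by
  induction n using Nat.strong_induction_on with
  | _ n ih =>
  -- Adding a hyperbolic plane raises the dimension by two and keeps the type.
  have step : ∀ m, n = m + 2 → Admissible m ε →
      ∃ (V : Type u) (_ : AddCommGroup V) (_ : Module k V) (_ : FiniteDimensional k V)
        (Q : QuadraticForm k V), finrank k V = n ∧ IsNondegenerate Q ∧ sgn Q = ε := by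
    intro m hm hadm
    obtain ⟨V, _, _, _, Q, h1, h2, h3⟩ := ih m (by lia) hadm
    refine ⟨V × k × k, inferInstance, inferInstance, inferInstance, Q.prod (hyperbolic k), ?_,
      isNondegenerate_prod_hyperbolic h2, (sgn_prod_hyperbolic h2).trans h3⟩
    rw [finrank_prod, finrank_prod, finrank_self, h1, hm]
  rcases h with ⟨hn, rfl⟩ | ⟨rfl, rfl⟩ | ⟨hn, hn0, hε⟩
  · rcases Nat.lt_or_ge n 2 with h2 | h2
    · obtain rfl : n = 1 := by
        obtain ⟨m, rfl⟩ := hn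
        lia
      refine ⟨k, inferInstance, inferInstance, inferInstance, QuadraticMap.sq, finrank_self k,
        isNondegenerate_of_anisotropic fun x hx => ?_, sgn_odd (by simp)⟩
      simpa using hx
    · refine step (n - 2) (by lia) (Or.inl ⟨?_, rfl⟩)
      rw [Nat.odd_iff] at hn ⊢
      lia
  · exact ⟨PUnit, inferInstance, inferInstance, inferInstance, 0, finrank_zero_of_subsingleton,
      isNondegenerate_of_anisotropic fun x _ => Subsingleton.elim _ _,
      sgn_eq_one_of_finrank_eq_zero finrank_zero_of_subsingleton⟩
  · rw [Nat.even_iff] at hn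
    rcases Nat.lt_or_ge 2 n with h2 | h2
    · exact step (n - 2) (by lia)
        (Or.inr (Or.inr ⟨by rw [Nat.even_iff]; lia, by lia, hε⟩))
    · obtain rfl : n = 2 := by lia
      rcases hε with rfl | rfl
      · exact step 0 rfl (Or.inr (Or.inl ⟨rfl, rfl⟩))
      -- For a nonsquare `a` the binary form `x² - a y²` is anisotropic, hence of type `-1`.
      · obtain ⟨a, ha⟩ := FiniteField.exists_nonsquare hk
        have hani : ∀ x : k × k, (QuadraticMap.prod (QuadraticMap.sq (R := k))
            (-a • QuadraticMap.sq (R := k)) : QuadraticForm k (k × k)) x = 0 → x = 0 := by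
          rintro ⟨x, y⟩ h
          simp only [QuadraticMap.prod_apply, smul_apply, QuadraticMap.sq_apply,
            smul_eq_mul] at h
          by_cases hy : y = 0
          · subst hy
            simpa using h
          · refine absurd ⟨x / y, ?_⟩ ha
            field_simp
            linear_combination -h
        have hd : finrank k (k × k) = 2 := by rw [finrank_prod, finrank_self]
        exact ⟨k × k, inferInstance, inferInstance, inferInstance, _, hd,
          isNondegenerate_of_anisotropic hani, sgn_eq_neg_one_of_anisotropic hani hd⟩

/-- `ULift` and `Shrink` move the field and the space into the independent universes over which
`IsPoly` quantifies. -/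
theorem exists_form_of_prime {p : ℕ} (hp : p.Prime) (hp2 : p ≠ 2) {n : ℕ} {ε : ℤ}
    (h : Admissible n ε) :
    ∃ (k : Type u) (_ : Field k) (_ : Finite k) (V : Type v) (_ : AddCommGroup V)
      (_ : Module k V) (_ : FiniteDimensional k V) (Q : QuadraticForm k V),
      Nat.card k = p ∧ finrank k V = n ∧ IsNondegenerate Q ∧ sgn Q = ε := by
  have := Fact.mk hp
  have hchar : ringChar (ULift.{u} (ZMod p)) ≠ 2 := by
    rwa [← Algebra.ringChar_eq (ZMod p) (ULift.{u} (ZMod p)), ZMod.ringChar_zmod_n]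
  obtain ⟨V, _, _, _, Q, h1, h2, h3⟩ := exists_form (ULift.{u} (ZMod p)) hchar n ε h
  have : Finite V := Module.finite_of_finite (ULift.{u} (ZMod p))
  let e := Shrink.linearEquiv.{v} (ULift.{u} (ZMod p)) V
  have he : ∀ v, Q.comp (e : Shrink.{v} V →ₗ[ULift.{u} (ZMod p)] V) (e.symm v) = Q v := by
    intro v
    simp
  refine ⟨ULift.{u} (ZMod p), inferInstance, inferInstance, Shrink.{v} V, inferInstance,
    inferInstance, Module.Finite.equiv e.symm, Q.comp e.toLinearMap, ?_, e.finrank_eq.trans h1,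
    isNondegenerate_of_equiv e.symm he h2, (sgn_equiv e.symm he).symm.trans h3⟩
  rw [Nat.card_ulift, Nat.card_zmod]

end Existence

/-! ### Polynomial counts and exact division. -/

section Division

/-- The remainder `R` of `P` modulo `M` has smaller degree, so at large primes `|R(p)| < |M(p)|`
while `M(p) ∣ R(p)`. Thus `R` has infinitely many roots. -/
theorem dvd_of_forall_prime_dvd_eval {M P : ℤ[X]} (hM : M.Monic)
    (h : ∀ p : ℕ, p.Prime → p ≠ 2 → M.eval (p : ℤ) ∣ P.eval (p : ℤ)) : M ∣ P := by
  rw [← modByMonic_eq_zero_iff_dvd hM]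
  set R := P %ₘ M with hR
  have hdeg : (R.map (Int.castRingHom ℝ)).degree < (M.map (Int.castRingHom ℝ)).degree := by
    rw [degree_map_eq_of_injective Int.cast_injective, degree_map_eq_of_injective Int.cast_injective]
    exact degree_modByMonic_lt P hM
  have hlim := (div_tendsto_atTop_zero_of_degree_lt _ _ hdeg).comp tendsto_natCast_atTop_atTop
  have hev : ∀ᶠ q : ℕ in Filter.atTop, q.Prime → q ≠ 2 → R.eval (q : ℤ) = 0 := by
    filter_upwards [hlim.eventually (Metric.ball_mem_nhds 0 one_pos)] with q hq hp hp2
    have hd : M.eval (q : ℤ) ∣ R.eval (q : ℤ) := by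
      rw [hR, modByMonic_eq_sub_mul_div, eval_sub, eval_mul]
      exact dvd_sub (h q hp hp2) (dvd_mul_right _ _)
    by_cases hM0 : M.eval (q : ℤ) = 0
    · exact zero_dvd_iff.1 (hM0 ▸ hd)
    refine Int.eq_zero_of_abs_lt_dvd ((abs_dvd _ _).2 hd) ?_
    have hcast : ∀ S : ℤ[X], (S.map (Int.castRingHom ℝ)).eval (q : ℝ) =
        ((S.eval (q : ℤ) : ℤ) : ℝ) := by
      intro S
      have := eval_map_apply (f := Int.castRingHom ℝ) (p := S) (q : ℤ)
      simpa only [Int.coe_castRingHom, Int.cast_natCast] using this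
    have hM1 : (0 : ℝ) < |((M.eval (q : ℤ) : ℤ) : ℝ)| := abs_pos.2 (by exact_mod_cast hM0)
    rw [Function.comp_apply, hcast, hcast, dist_zero_right, norm_div, Real.norm_eq_abs,
      Real.norm_eq_abs, div_lt_one hM1] at hq
    exact_mod_cast hq
  obtain ⟨N, hN⟩ := Filter.eventually_atTop.1 hev
  refine eq_zero_of_infinite_isRoot R (Set.infinite_of_forall_exists_gt fun a => ?_)
  obtain ⟨p, hp, hprime⟩ := Nat.exists_infinite_primes (N + a.natAbs + 3)
  exact ⟨p, hN p (by lia) hprime (by lia), by lia⟩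

theorem dvd_of_dvd_add_self {M P : ℤ[X]} (hM : M.Monic) (h : M ∣ P + P) : M ∣ P := by
  rw [← modByMonic_eq_zero_iff_dvd hM] at h ⊢
  rw [add_modByMonic, ← two_mul] at h
  exact (mul_eq_zero.1 h).resolve_left two_ne_zero

/-- On nondegenerate forms of dimension `n`, the function `f` is given by polynomials with
integer coefficients in the size of the field, linearly in the type of the form. -/
def IsPoly (n : ℕ) (f : ∀ (k : Type u) [Field k] (V : Type v) [AddCommGroup V] [Module k V],
    QuadraticForm k V → ℤ) : Prop :=
  ∃ C D : ℤ[X], ∀ (k : Type u) [Field k] [Finite k] (V : Type v) [AddCommGroup V] [Module k V]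
    [FiniteDimensional k V] (Q : QuadraticForm k V), finrank k V = n → IsNondegenerate Q →
    f k V Q = C.eval (Nat.card k : ℤ) + sgn Q * D.eval (Nat.card k : ℤ)

variable {n : ℕ} {f g : ∀ (k : Type u) [Field k] (V : Type v) [AddCommGroup V] [Module k V],
    QuadraticForm k V → ℤ}

theorem sgn_admissible {k V : Type*} [Field k] [AddCommGroup V] [Module k V]
    (Q : QuadraticForm k V) : Admissible (finrank k V) (sgn Q) := by
  by_cases h : Even (finrank k V)
  · rcases Nat.eq_zero_or_pos (finrank k V) with h0 | h0
    · exact Or.inr (Or.inl ⟨h0, sgn_eq_one_of_finrank_eq_zero h0⟩)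
    · refine Or.inr (Or.inr ⟨h, h0, ?_⟩)
      rw [sgn_even h]
      rcases Int.units_eq_one_or (formType Q) with h1 | h1 <;> simp [h1]
  · exact Or.inl ⟨Nat.not_even_iff_odd.1 h, sgn_odd h⟩

/-- The square of `sgn` depends only on the dimension, which keeps products of counts linear in
`sgn` (`IsPoly.mul`). -/
theorem Admissible.sq {n : ℕ} {ε ε' : ℤ} (h : Admissible n ε) (h' : Admissible n ε') :
    ε * ε = ε' * ε' := by
  rw [Admissible, ← Nat.not_even_iff_odd] at h h'
  rcases h with ⟨hn, rfl⟩ | ⟨hn, rfl⟩ | ⟨hn, h0, rfl | rfl⟩ <;>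
  rcases h' with ⟨hn', rfl⟩ | ⟨hn', rfl⟩ | ⟨hn', h0', rfl | rfl⟩ <;>
  simp_all

/-- For each admissible `ε`, actual forms over prime fields show that `M` divides `C + ε D`, because
`f` takes integer values. -/
theorem IsPoly.div {M : ℤ[X]} (hM : M.Monic) (hM0 : ∀ q : ℤ, 2 ≤ q → M.eval q ≠ 0)
    (h : IsPoly n fun k _ V _ _ Q => M.eval (Nat.card k : ℤ) * f k V Q) : IsPoly n f := by
  obtain ⟨C, D, hCD⟩ := h
  have hdvd : ∀ ε : ℤ, Admissible n ε → M ∣ C + Polynomial.C ε * D := by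
    intro ε hε
    refine dvd_of_forall_prime_dvd_eval hM fun p hp hp2 => ?_
    obtain ⟨k, _, _, V, _, _, _, Q, h1, h2, h3, h4⟩ := exists_form_of_prime.{u, v} hp hp2 hε
    have := hCD k V Q h2 h3
    beta_reduce at this
    rw [h1, h4] at this
    simp only [eval_add, eval_mul, eval_C]
    exact Dvd.intro _ this
  obtain ⟨C', D', hCD'⟩ : ∃ C' D' : ℤ[X], ∀ ε : ℤ, Admissible n ε →
      C + Polynomial.C ε * D = M * (C' + Polynomial.C ε * D') := by
    by_cases hn : Even n ∧ 0 < n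
    · have h1 := hdvd 1 (Or.inr (Or.inr ⟨hn.1, hn.2, Or.inl rfl⟩))
      have h2 := hdvd (-1) (Or.inr (Or.inr ⟨hn.1, hn.2, Or.inr rfl⟩))
      -- Both signs occur: adding the two divisibilities gives `M ∣ 2C`, and the monic `M` allows
      -- the factor `2` to be dropped.
      have h3 : M ∣ C := by
        refine dvd_of_dvd_add_self hM ?_
        convert dvd_add h1 h2 using 1
        simp only [map_one, map_neg]
        ring
      have h4 : M ∣ D := by
        rw [map_one, one_mul] at h1
        exact (dvd_add_right h3).1 h1
      obtain ⟨C', rfl⟩ := h3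
      obtain ⟨D', rfl⟩ := h4
      exact ⟨C', D', fun ε _ => by ring⟩
    -- Only one sign occurs, so `C` and `D` need not be divisible separately; the whole quotient
    -- becomes `C'`, with `D' = 0`.
    · obtain ⟨ε, hε, huniq⟩ : ∃ ε, Admissible n ε ∧ ∀ ε', Admissible n ε' → ε' = ε := by
        by_cases h0 : n = 0
        · refine ⟨1, Or.inr (Or.inl ⟨h0, rfl⟩), ?_⟩
          rintro ε' (⟨h1, rfl⟩ | ⟨-, rfl⟩ | ⟨h1, h2, -⟩)
          · simp [h0] at h1
          · rfl
          · lia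
        · have ho : Odd n := Nat.not_even_iff_odd.1 fun he => hn ⟨he, Nat.pos_of_ne_zero h0⟩
          refine ⟨0, Or.inl ⟨ho, rfl⟩, ?_⟩
          rintro ε' (⟨h1, rfl⟩ | ⟨h1, rfl⟩ | ⟨h1, h2, -⟩)
          · rfl
          · exact absurd h1 h0
          · exact absurd ⟨h1, h2⟩ hn
      obtain ⟨E, hE⟩ := hdvd ε hε
      refine ⟨E, 0, fun ε' hε' => ?_⟩
      rw [huniq ε' hε', hE, mul_zero, add_zero]
  refine ⟨C', D', fun k _ _ V _ _ _ Q hV hQ => ?_⟩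
  have h1 := hCD k V Q hV hQ
  have h2 := congrArg (eval (Nat.card k : ℤ)) (hCD' (sgn Q) (hV ▸ sgn_admissible Q))
  simp only [eval_add, eval_mul, eval_C] at h2
  have hq : (2 : ℤ) ≤ Nat.card k := by exact_mod_cast Finite.one_lt_card (α := k)
  exact mul_left_cancel₀ (hM0 _ hq) (h1.trans h2)

theorem IsPoly.congr (hf : IsPoly n f)
    (h : ∀ (k : Type u) [Field k] [Finite k] (V : Type v) [AddCommGroup V] [Module k V]
      [FiniteDimensional k V] (Q : QuadraticForm k V), finrank k V = n → IsNondegenerate Q →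
      g k V Q = f k V Q) : IsPoly n g := by
  obtain ⟨C, D, hCD⟩ := hf
  exact ⟨C, D, fun k _ _ V _ _ _ Q hV hQ => (h k V Q hV hQ).trans (hCD k V Q hV hQ)⟩

theorem IsPoly.add (hf : IsPoly n f) (hg : IsPoly n g) :
    IsPoly n fun k _ V _ _ Q => f k V Q + g k V Q := by
  obtain ⟨C, D, hCD⟩ := hf
  obtain ⟨C', D', hCD'⟩ := hg
  refine ⟨C + C', D + D', fun k _ _ V _ _ _ Q hV hQ => ?_⟩
  simp only [hCD k V Q hV hQ, hCD' k V Q hV hQ, eval_add]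
  ring

theorem IsPoly.mul (hf : IsPoly n f) (hg : IsPoly n g) :
    IsPoly n fun k _ V _ _ Q => f k V Q * g k V Q := by
  obtain ⟨C, D, hCD⟩ := hf
  obtain ⟨C', D', hCD'⟩ := hg
  obtain ⟨ε, hε⟩ := exists_admissible n
  refine ⟨C * C' + Polynomial.C (ε * ε) * (D * D'), C * D' + D * C',
    fun k _ _ V _ _ _ Q hV hQ => ?_⟩
  have hsq : sgn Q * sgn Q = ε * ε := (hV ▸ sgn_admissible Q : Admissible n (sgn Q)).sq hε
  simp only [hCD k V Q hV hQ, hCD' k V Q hV hQ, eval_add, eval_mul, eval_C, ← hsq]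
  ring

theorem isPoly_eval (P : ℤ[X]) :
    IsPoly.{u, v} n fun k _ _ _ _ _ => P.eval (Nat.card k : ℤ) :=
  ⟨P, 0, fun _ _ _ _ _ _ _ _ _ _ => by simp⟩

theorem IsPoly.neg (hf : IsPoly n f) : IsPoly n fun k _ V _ _ Q => - f k V Q :=
  ((isPoly_eval (-1)).mul hf).congr fun _ _ _ _ _ _ _ _ _ _ => by simp

theorem IsPoly.sum {ι : Type*} (s : Finset ι)
    {F : ι → ∀ (k : Type u) [Field k] (V : Type v) [AddCommGroup V] [Module k V],
      QuadraticForm k V → ℤ} (h : ∀ i ∈ s, IsPoly n (F i)) :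
    IsPoly n fun k _ V _ _ Q => ∑ i ∈ s, F i k V Q := by
  classical
  induction s using Finset.induction_on with
  | empty => exact (isPoly_eval 0).congr fun _ _ _ _ _ _ _ _ _ _ => by simp
  | insert a s ha ih =>
    refine ((h a (Finset.mem_insert_self a s)).add
      (ih fun i hi => h i (Finset.mem_insert_of_mem hi))).congr fun _ _ _ _ _ _ _ _ _ _ => ?_
    rw [Finset.sum_insert ha]

theorem isPoly_sgn : IsPoly.{u, v} n fun _ _ _ _ _ Q => sgn Q :=
  ⟨0, 1, fun _ _ _ _ _ _ _ _ _ _ => by simp⟩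

end Division

/-! ### Double counting of vectors and subspaces. -/

section Counting

variable {k V : Type*} [Field k] [AddCommGroup V] [Module k V]

/-- The correspondence theorem for `Y / x`, with `V'` in place of the quotient. -/
theorem finsum_submodule_mem_le {x : V} {V' Y : Submodule k V} (hY : V' ⊔ k ∙ x = Y)
    (hV : V' ⊓ k ∙ x = ⊥) (g : Submodule k V → ℤ) :
    ∑ᶠ U ∈ {U : Submodule k V | x ∈ U ∧ U ≤ Y}, g U =
      ∑ᶠ U : Submodule k V', g (U.map V'.subtype ⊔ k ∙ x) := by
  have hinj : Function.Injective fun U : Submodule k V' => U.map V'.subtype ⊔ k ∙ x := by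
    intro U U' h
    have h1 := congrArg (· ⊓ V') h
    simp only [sup_span_inf hV (Submodule.map_subtype_le V' _)] at h1
    exact Submodule.map_injective_of_injective V'.injective_subtype h1
  have hrange : {U : Submodule k V | x ∈ U ∧ U ≤ Y} =
      Set.range fun U : Submodule k V' => U.map V'.subtype ⊔ k ∙ x := by
    ext U
    constructor
    · rintro ⟨hx, hU⟩
      refine ⟨U.comap V'.subtype, ?_⟩
      simp only [Submodule.map_comap_subtype]
      rw [inf_comm, inf_sup_span hY hU hx]
    · rintro ⟨U', rfl⟩
      exact ⟨mem_sup_span_iff.2 ⟨0, zero_mem _, 1, by simp⟩,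
        hY ▸ sup_le_sup_right (Submodule.map_subtype_le V' _) _⟩
  rw [hrange, finsum_mem_range hinj]

theorem finsum_mul_card [Finite V] (S : Submodule k V → Set V) (c : Submodule k V → ℤ) :
    ∑ᶠ U, c U * Nat.card (S U) = ∑ᶠ x, ∑ᶠ U ∈ {U | x ∈ S U}, c U := by
  classical
  have := Fintype.ofFinite V
  have := Fintype.ofFinite (Submodule k V)
  rw [finsum_eq_sum_of_fintype, finsum_eq_sum_of_fintype]
  have h1 : ∀ U, c U * Nat.card (S U) = ∑ x, if x ∈ S U then c U else 0 := by
    intro U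
    rw [← Finset.sum_filter, Finset.sum_const, nsmul_eq_mul, mul_comm, Nat.card_eq_fintype_card,
      Fintype.card_subtype]
  simp only [h1]
  rw [Finset.sum_comm]
  refine Finset.sum_congr rfl fun x _ => ?_
  rw [finsum_mem_eq_finite_toFinset_sum _ (Set.toFinite _), ← Finset.sum_filter]
  exact Finset.sum_congr (by ext; simp) fun _ _ => rfl

theorem finsum_mem_const {α : Type*} [Finite α] (s : Set α) (c : ℤ) : ∑ᶠ x ∈ s, c = Nat.card s * c := by
  rw [finsum_mem_eq_finite_toFinset_sum _ (Set.toFinite s), Finset.sum_const, nsmul_eq_mul,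
    Nat.card_eq_card_finite_toFinset]

variable [Finite k] [FiniteDimensional k V]

theorem card_ne_zero_mem_add_one (U : Submodule k V) :
    Nat.card {x : V | x ≠ 0 ∧ x ∈ U} + 1 = Nat.card k ^ finrank k U := by
  have : Finite V := Module.finite_of_finite k
  rw [← natCard_eq_pow_finrank (K := k) (V := U), Nat.card_coe_set_eq]
  have h1 : {x : V | x ≠ 0 ∧ x ∈ U} = (U : Set V) \ {0} := by
    ext
    simp [and_comm]
  rw [h1, Set.ncard_sdiff_singleton_add_one U.zero_mem, ← Nat.card_coe_set_eq]
  rfl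

theorem card_ne_zero_zero_add_one (Q : QuadraticForm k V) (U : Submodule k V) :
    Nat.card {x : V | x ≠ 0 ∧ x ∈ U ∧ Q x = 0} + 1 = zeroCount Q U := by
  have : Finite V := Module.finite_of_finite k
  have h1 : {x : V | x ≠ 0 ∧ x ∈ U ∧ Q x = 0} = {x : V | x ∈ U ∧ Q x = 0} \ {0} := by
    ext
    simp [and_comm]
  rw [Nat.card_coe_set_eq, h1, Set.ncard_sdiff_singleton_add_one (by simp),
    ← Nat.card_coe_set_eq]
  rfl

end Counting

/-! ### Counting subspaces by the dimension of their singular radical. -/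

section Subspaces

/-- The number of subspaces of dimension `m`. -/
noncomputable def subspaceCount (m : ℕ) (k : Type*) [Field k] (V : Type*) [AddCommGroup V]
    [Module k V] : ℤ :=
  ∑ᶠ U : Submodule k V, if finrank k U = m then 1 else 0

theorem finsum_finrank_zero {k V : Type*} [Field k] [AddCommGroup V]
    [Module k V] [FiniteDimensional k V] (g : Submodule k V → ℤ) :
    (∑ᶠ U : Submodule k V, if finrank k U = 0 then g U else 0) = g ⊥ := by
  rw [finsum_eq_single _ ⊥, if_pos (finrank_bot k V)]
  intro U hU
  rw [if_neg fun h => hU (Submodule.finrank_eq_zero.1 h)]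

theorem finsum_mem_subspace {k V : Type*} [Field k] [AddCommGroup V] [Module k V]
    [FiniteDimensional k V] {x : V} (hx0 : x ≠ 0) {V' : Submodule k V} (hY : V' ⊔ k ∙ x = ⊤)
    (hV : V' ⊓ k ∙ x = ⊥) (m : ℕ) :
    (∑ᶠ U ∈ {U : Submodule k V | x ∈ U}, if finrank k U = m + 1 then (1 : ℤ) else 0) =
      subspaceCount m k V' := by
  have h := finsum_submodule_mem_le hY hV fun U => if finrank k U = m + 1 then (1 : ℤ) else 0
  simp only [le_top, and_true] at h
  rw [h, subspaceCount]
  refine finsum_congr fun U => ?_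
  rw [finrank_sup_span hx0 hV (Submodule.map_subtype_le V' U), finrank_map_subtype']
  simp

theorem finrank_compl_top {k V : Type*} [Field k] [AddCommGroup V] [Module k V]
    [FiniteDimensional k V] {x : V} (hx0 : x ≠ 0) {V' : Submodule k V} (hY : V' ⊔ k ∙ x = ⊤)
    (hV : V' ⊓ k ∙ x = ⊥) : finrank k V' + 1 = finrank k V := by
  rw [← finrank_sup_span hx0 hV le_rfl, hY, finrank_top]

theorem pow_sub_one_ne_zero (s : ℕ) (q : ℤ) (hq : 2 ≤ q) :
    (X ^ (s + 1) - 1 : ℤ[X]).eval q ≠ 0 := by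
  have : 1 < q ^ (s + 1) := one_lt_pow₀ (by lia) (by lia)
  simp only [eval_sub, eval_pow, eval_X, eval_one]
  lia

/-- Counting pairs `(x, U)` with `0 ≠ x ∈ U` gives the recursion of Gaussian binomials, and
divisibility is again tested at primes. -/
theorem exists_subspaceCount_eq (m n : ℕ) : ∃ P : ℤ[X], ∀ (k : Type u) [Field k] [Finite k]
    (V : Type v) [AddCommGroup V] [Module k V] [FiniteDimensional k V], finrank k V = n →
    subspaceCount m k V = P.eval (Nat.card k : ℤ) := by
  induction m generalizing n with
  | zero =>
    refine ⟨1, fun k _ _ V _ _ _ _ => ?_⟩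
    rw [subspaceCount, finsum_finrank_zero fun _ => 1, eval_one]
  | succ m ih =>
    -- For `n = 0` the truncated value is harmless: there is no nonzero `x`.
    obtain ⟨P, hP⟩ := ih (n - 1)
    have key : ∀ (k : Type u) [Field k] [Finite k] (V : Type v) [AddCommGroup V] [Module k V]
        [FiniteDimensional k V], finrank k V = n →
        (X ^ (m + 1) - 1 : ℤ[X]).eval (Nat.card k : ℤ) * subspaceCount (m + 1) k V =
          ((X ^ n - 1) * P).eval (Nat.card k : ℤ) := by
      intro k _ _ V _ _ _ hV
      have : Finite V := Module.finite_of_finite k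
      have h1 := finsum_mul_card (fun U : Submodule k V => {x : V | x ≠ 0 ∧ x ∈ U})
        fun U => if finrank k U = m + 1 then 1 else 0
      have h2 : ∀ U : Submodule k V, (if finrank k U = m + 1 then (1 : ℤ) else 0) *
          Nat.card {x : V | x ≠ 0 ∧ x ∈ U} = (Nat.card k ^ (m + 1) - 1 : ℤ) *
            if finrank k U = m + 1 then 1 else 0 := by
        intro U
        have := card_ne_zero_mem_add_one U
        split_ifs with hU
        · rw [hU] at this
          zify at this
          rw [← this]
          ring
        · simp
      -- The sum over a proposition on the right acts as an indicator, so the vectors `x` that do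
      -- not count contribute `0`.
      have h3 : ∀ x : V, (∑ᶠ U ∈ {U : Submodule k V | x ∈ {x : V | x ≠ 0 ∧ x ∈ U}},
          if finrank k U = m + 1 then (1 : ℤ) else 0) =
          ∑ᶠ _ : x ∈ {x : V | x ≠ 0 ∧ x ∈ (⊤ : Submodule k V)}, P.eval (Nat.card k : ℤ) := by
        intro x
        by_cases hx0 : x = 0
        · simp [hx0]
        · obtain ⟨V', hY, hV'⟩ := exists_compl_span (⊤ : Submodule k V) (x := x) trivial
          have hd := finrank_compl_top hx0 hY hV'
          have h4 := hP k V' (by lia)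
          rw [← h4, ← finsum_mem_subspace hx0 hY hV']
          simp [hx0]
      simp only [h2, h3] at h1
      rw [← mul_finsum, finsum_mem_const] at h1
      have h5 := card_ne_zero_mem_add_one (⊤ : Submodule k V)
      rw [finrank_top, hV] at h5
      zify at h5
      rw [← eq_sub_iff_add_eq] at h5
      simp only [eval_sub, eval_pow, eval_X, eval_one, eval_mul]
      rw [← h5]
      exact h1
    have hM : (X ^ (m + 1) - 1 : ℤ[X]).Monic := monic_X_pow_sub_C 1 (Nat.succ_ne_zero m)
    obtain ⟨ε, hε⟩ := exists_admissible n
    obtain ⟨R, hR⟩ := dvd_of_forall_prime_dvd_eval (P := (X ^ n - 1) * P) hM fun p hp hp2 => by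
      -- Only the field and the space matter here; the form is a by-product.
      obtain ⟨k, _, _, V, _, _, _, Q, h1, h2, h3, h4⟩ := exists_form_of_prime.{u, v} hp hp2 hε
      rw [← h1]
      exact Dvd.intro _ (key k V h2)
    refine ⟨R, fun k _ _ V _ _ _ hV => ?_⟩
    have h1 := key k V hV
    rw [hR, eval_mul] at h1
    exact mul_left_cancel₀ (pow_sub_one_ne_zero m _ (by exact_mod_cast Finite.one_lt_card (α := k)))
      h1

/-- The sum of the `b`-th powers of the numbers of zeros of `Q` on the subspaces
of dimension `m`. -/
noncomputable def totalSum (b m : ℕ) (k : Type*) [Field k] (V : Type*) [AddCommGroup V]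
    [Module k V] (Q : QuadraticForm k V) : ℤ :=
  ∑ᶠ U : Submodule k V, if finrank k U = m then (zeroCount Q U : ℤ) ^ b else 0

/-- The sum of the `b`-th powers of the numbers of zeros of `Q` on the subspaces
of dimension `m` on which the singular radical has dimension `s`. -/
noncomputable def radSum (b m s : ℕ) (k : Type*) [Field k] (V : Type*) [AddCommGroup V]
    [Module k V] (Q : QuadraticForm k V) : ℤ :=
  ∑ᶠ U : Submodule k V,
    if finrank k U = m ∧ finrank k (singRad Q U) = s then (zeroCount Q U : ℤ) ^ b else 0

theorem isPoly_zeroCount (n : ℕ) :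
    IsPoly.{u, v} n fun _ _ _ _ _ Q => (zeroCount Q ⊤ : ℤ) := by
  refine IsPoly.div (M := X) monic_X (fun q hq => by rw [eval_X]; lia) ?_
  refine ((isPoly_eval (X ^ n)).add
    (isPoly_sgn.mul (isPoly_eval ((X - 1) * X ^ (n / 2))))).congr ?_
  intro k _ _ V _ _ _ Q hV hQ
  have := zeroCount_top Q hQ
  rw [hV] at this
  simpa using this

theorem isPoly_totalSum_zero (m n : ℕ) : IsPoly.{u, v} n (totalSum 0 m) := by
  obtain ⟨P, hP⟩ := exists_subspaceCount_eq.{u, v} m n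
  refine (isPoly_eval P).congr fun k _ _ V _ _ _ Q hV _ => ?_
  rw [← hP k V hV, totalSum, subspaceCount]
  simp only [pow_zero]

theorem zeroCount_bot {k V : Type*} [Field k] [AddCommGroup V] [Module k V]
    (Q : QuadraticForm k V) : zeroCount Q ⊥ = 1 := by
  rw [zeroCount, Nat.card_eq_one_iff_unique]
  refine ⟨⟨fun a b => Subtype.ext ?_⟩, ⟨⟨0, zero_mem _, by simp⟩⟩⟩
  rw [(Submodule.mem_bot k).1 a.2.1, (Submodule.mem_bot k).1 b.2.1]

/-- Pairs `(x, U)` with `x ∈ U` singular and nonzero: each `U` contributes its zero count minus one,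
and each `x` lies in as many `U` as there are `m`-dimensional subspaces in a complement of `x`. -/
theorem isPoly_totalSum_one (m n : ℕ) : IsPoly.{u, v} n (totalSum 1 m) := by
  cases m with
  | zero =>
    refine (isPoly_eval 1).congr fun k _ _ V _ _ _ Q _ _ => ?_
    rw [totalSum, finsum_finrank_zero fun U => (zeroCount Q U : ℤ) ^ 1, zeroCount_bot]
    simp
  | succ m =>
    obtain ⟨P, hP⟩ := exists_subspaceCount_eq.{u, v} m (n - 1)
    refine ((isPoly_totalSum_zero (m + 1) n).add
      (((isPoly_zeroCount n).add (isPoly_eval (-1))).mul (isPoly_eval P))).congr ?_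
    intro k _ _ V _ _ _ Q hV _
    have : Finite V := Module.finite_of_finite k
    have h1 := finsum_mul_card (fun U : Submodule k V => {x : V | x ≠ 0 ∧ x ∈ U ∧ Q x = 0})
      fun U => if finrank k U = m + 1 then 1 else 0
    have h3 : ∀ x : V, (∑ᶠ U ∈ {U : Submodule k V | x ∈ {x : V | x ≠ 0 ∧ x ∈ U ∧ Q x = 0}},
        if finrank k U = m + 1 then (1 : ℤ) else 0) =
        ∑ᶠ _ : x ∈ {x : V | x ≠ 0 ∧ x ∈ (⊤ : Submodule k V) ∧ Q x = 0},
          P.eval (Nat.card k : ℤ) := by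
      intro x
      by_cases hx : x ≠ 0 ∧ Q x = 0
      · obtain ⟨hx0, hx⟩ := hx
        obtain ⟨V', hY, hV'⟩ := exists_compl_span (⊤ : Submodule k V) (x := x) trivial
        have hd := finrank_compl_top hx0 hY hV'
        have h4 := hP k V' (by lia)
        rw [← h4, ← finsum_mem_subspace hx0 hY hV']
        simp [hx0, hx]
      · have hne : ∀ U : Submodule k V, ¬ (x ≠ 0 ∧ x ∈ U ∧ Q x = 0) := fun U h => hx ⟨h.1, h.2.2⟩
        simp only [Set.mem_ofPred_eq, hne, finsum_false, finsum_zero]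
    simp only [h3] at h1
    rw [finsum_mem_const] at h1
    have h5 := card_ne_zero_zero_add_one Q ⊤
    zify at h5
    rw [eval_neg, eval_one, ← h5, add_neg_cancel_right, ← h1, totalSum, totalSum,
      ← finsum_add_distrib (Set.toFinite _) (Set.toFinite _)]
    refine finsum_congr fun U => ?_
    have h6 := card_ne_zero_zero_add_one Q U
    zify at h6
    split_ifs
    · rw [← h6]
      ring
    · simp

/-- Pairs `(x, U)` with `x ≠ 0` in the singular radical of `U`. Each `U` has `q^(s+1) - 1` such `x`;
for fixed `x`, passing to `x^⊥/x` lowers `m` and `s` by one and divides the zero count by `q`,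
whence the factor `q^b`. -/
theorem radSum_rec {k V : Type*} [Field k] [Finite k] [AddCommGroup V] [Module k V]
    [FiniteDimensional k V] (Q : QuadraticForm k V) (b m s : ℕ) (c : ℤ)
    (hc : ∀ x ≠ 0, Q x = 0 → ∃ V' : Submodule k V, V' ⊔ k ∙ x = perp Q x ∧ V' ⊓ k ∙ x = ⊥ ∧
      radSum b m s k V' (Q.restrict V') = c) :
    ((Nat.card k : ℤ) ^ (s + 1) - 1) * radSum b (m + 1) (s + 1) k V Q =
      (zeroCount Q ⊤ - 1) * (Nat.card k ^ b * c) := by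
  have : Finite V := Module.finite_of_finite k
  have h1 := finsum_mul_card (fun U : Submodule k V => {x : V | x ≠ 0 ∧ x ∈ singRad Q U})
    fun U => if finrank k U = m + 1 ∧ finrank k (singRad Q U) = s + 1 then
      (zeroCount Q U : ℤ) ^ b else 0
  have h2 : ∀ U : Submodule k V, (if finrank k U = m + 1 ∧ finrank k (singRad Q U) = s + 1 then
      (zeroCount Q U : ℤ) ^ b else 0) * Nat.card {x : V | x ≠ 0 ∧ x ∈ singRad Q U} =
      (Nat.card k ^ (s + 1) - 1 : ℤ) *
        if finrank k U = m + 1 ∧ finrank k (singRad Q U) = s + 1 then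
          (zeroCount Q U : ℤ) ^ b else 0 := by
    intro U
    have := card_ne_zero_mem_add_one (singRad Q U)
    split_ifs with hU
    · rw [hU.2] at this
      zify at this
      rw [← this]
      ring
    · simp
  have h3 : ∀ x : V, (∑ᶠ U ∈ {U : Submodule k V | x ∈ {x : V | x ≠ 0 ∧ x ∈ singRad Q U}},
      if finrank k U = m + 1 ∧ finrank k (singRad Q U) = s + 1 then
        (zeroCount Q U : ℤ) ^ b else 0) =
      ∑ᶠ _ : x ∈ {x : V | x ≠ 0 ∧ x ∈ (⊤ : Submodule k V) ∧ Q x = 0}, Nat.card k ^ b * c := by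
    intro x
    by_cases hx : x ≠ 0 ∧ Q x = 0
    · obtain ⟨hx0, hx⟩ := hx
      obtain ⟨V', hY, hV, hV'⟩ := hc x hx0 hx
      have hset : {U : Submodule k V | x ∈ {x : V | x ≠ 0 ∧ x ∈ singRad Q U}} =
          {U | x ∈ U ∧ U ≤ perp Q x} := by
        ext U
        simp only [Set.mem_ofPred_eq, mem_singRad, hx, true_and, SetLike.le_def, mem_perp]
        exact and_iff_right hx0
      have hR : (∑ᶠ _ : x ∈ {x : V | x ≠ 0 ∧ x ∈ (⊤ : Submodule k V) ∧ Q x = 0},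
          (Nat.card k : ℤ) ^ b * c) = Nat.card k ^ b * c := by
        simp [hx0, hx]
      rw [hset, finsum_submodule_mem_le hY hV, hR, ← hV', radSum,
        mul_finsum]
      refine finsum_congr fun U => ?_
      have hle := Submodule.map_subtype_le V' U
      rw [finrank_sup_span hx0 hV hle, singRad_sup_span hx hY hle,
        finrank_sup_span hx0 hV ((singRad_le _ _).trans hle), zeroCount_sup_span hx0 hx hY hV hle,
        zeroCount_restrict, ← map_singRad_restrict, finrank_map_subtype', finrank_map_subtype']
      simp only [Nat.add_right_cancel_iff, mul_ite, mul_zero]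
      push_cast
      rw [mul_pow]
    · have hne : ∀ U : Submodule k V, ¬ (x ≠ 0 ∧ x ∈ singRad Q U) := fun U h => hx ⟨h.1, h.2.2.1⟩
      have hne' : ¬ (x ≠ 0 ∧ x ∈ (⊤ : Submodule k V) ∧ Q x = 0) := fun h => hx ⟨h.1, h.2.2⟩
      simp only [Set.mem_ofPred_eq, hne, hne', finsum_false, finsum_zero]
  simp only [h2, h3] at h1
  rw [← mul_finsum, finsum_mem_const] at h1
  have h5 := card_ne_zero_zero_add_one Q ⊤
  zify at h5
  rw [← h5, add_sub_cancel_right]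
  exact h1

theorem totalSum_eq_sum_radSum {k V : Type*} [Field k] [Finite k] [AddCommGroup V] [Module k V]
    [FiniteDimensional k V] (Q : QuadraticForm k V) (b m : ℕ) :
    totalSum b m k V Q = ∑ s ∈ Finset.range (m + 1), radSum b m s k V Q := by
  have : Finite V := Module.finite_of_finite k
  simp only [radSum, totalSum]
  rw [← finsum_sum_comm _ _ fun _ _ => Set.toFinite _]
  refine finsum_congr fun U => ?_
  by_cases hU : finrank k U = m
  · have := Submodule.finrank_mono (singRad_le Q U)
    simp only [hU, true_and, if_true]
    rw [Finset.sum_ite_eq, if_pos (Finset.mem_range.2 (by lia))]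
  · simp [hU]

/-- A positive radical dimension comes from the recursion; radical dimension zero is what remains of
the total. -/
theorem isPoly_radSum (b : ℕ) (hb : ∀ m n, IsPoly.{u, v} n (totalSum b m)) (m n s : ℕ) :
    IsPoly.{u, v} n (radSum b m s) := by
  induction m generalizing n s with
  | zero =>
    cases s with
    | zero =>
      refine (hb 0 n).congr fun k _ _ V _ _ _ Q _ _ => ?_
      rw [totalSum_eq_sum_radSum]
      simp
    | succ s =>
      refine (isPoly_eval 0).congr fun k _ _ V _ _ _ Q _ _ => ?_
      rw [eval_zero, radSum]
      refine finsum_eq_zero_of_forall_eq_zero fun U => if_neg ?_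
      rintro ⟨h1, h2⟩
      have := Submodule.finrank_mono (singRad_le Q U)
      lia
  | succ m ih =>
    have hsucc : ∀ s, IsPoly.{u, v} n (radSum b (m + 1) (s + 1)) := by
      intro s
      obtain ⟨C, D, hCD⟩ := ih (n - 2) s
      refine IsPoly.div (M := X ^ (s + 1) - 1) (monic_X_pow_sub_C 1 (Nat.succ_ne_zero s))
        (pow_sub_one_ne_zero s) ?_
      refine (((isPoly_zeroCount n).add (isPoly_eval (-1))).mul ((isPoly_eval (X ^ b)).mul
        ((isPoly_eval C).add (isPoly_sgn.mul (isPoly_eval D))))).congr ?_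
      intro k _ _ V _ _ _ Q hV hQ
      simp only [eval_sub, eval_pow, eval_X, eval_one, eval_neg]
      refine radSum_rec Q b m s _ fun x hx0 hx => ?_
      obtain ⟨V', hY, hV'⟩ := exists_compl_span (perp Q x) (mem_perp_self hx)
      have hd := finrank_compl hQ hx0 hx hY hV'
      refine ⟨V', hY, hV', ?_⟩
      -- Invariance of the type makes the value on `V'` the same for every `x`, and linear in `sgn
      -- Q`.
      rw [← sgn_compl hQ hx0 hx hY hV']
      exact hCD k V' _ (by lia) (isNondegenerate_compl hQ hx0 hx hY hV')
    cases s with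
    | succ s => exact hsucc s
    | zero =>
      refine ((hb (m + 1) n).add
        (IsPoly.sum (Finset.range (m + 1)) fun s _ => hsucc s).neg).congr ?_
      intro k _ _ V _ _ _ Q _ _
      rw [totalSum_eq_sum_radSum, Finset.sum_range_succ']
      ring

end Subspaces

/-! ### Type sums and chains. -/

section Chains

/-- The sum of the types of the nondegenerate subspaces of dimension `m`. -/
noncomputable def typeSum (m : ℕ) (k : Type*) [Field k] (V : Type*) [AddCommGroup V]
    [Module k V] (Q : QuadraticForm k V) : ℤ :=
  ∑ᶠ U : Submodule k V,
    if finrank k U = m ∧ finrank k (singRad Q U) = 0 then sgn (Q.restrict U) else 0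

theorem isNondegenerate_restrict_iff_finrank {k V : Type*} [Field k] [AddCommGroup V] [Module k V]
    [FiniteDimensional k V] {Q : QuadraticForm k V} {U : Submodule k V} :
    IsNondegenerate (Q.restrict U) ↔ finrank k (singRad Q U) = 0 := by
  rw [isNondegenerate_restrict_iff, Submodule.finrank_eq_zero]

/-- Solving `zeroCount_top` for the type on each nondegenerate `U` and summing expresses the type
sum through `radSum` with `b = 1` and `b = 0`, after division by `(q - 1) q^(m/2)`. -/
theorem isPoly_typeSum (m n : ℕ) : IsPoly.{u, v} n (typeSum m) := by
  refine IsPoly.div (M := (X - 1) * X ^ (m / 2)) ((monic_X_sub_C 1).mul (monic_X_pow _))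
    (fun q hq => ?_) ?_
  · simp only [eval_sub, eval_pow, eval_X, eval_one, eval_mul]
    exact mul_ne_zero (by lia) (pow_ne_zero _ (by lia))
  · refine (((isPoly_eval X).mul (isPoly_radSum 1 (fun m n => isPoly_totalSum_one m n) m n 0)).add
      ((isPoly_eval (X ^ m)).mul
        (isPoly_radSum 0 (fun m n => isPoly_totalSum_zero m n) m n 0)).neg).congr ?_
    intro k _ _ V _ _ _ Q _ _
    have : Finite V := Module.finite_of_finite k
    rw [eq_add_neg_iff_add_eq, typeSum, radSum, radSum, mul_finsum, mul_finsum, mul_finsum,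
      ← finsum_add_distrib (Set.toFinite _) (Set.toFinite _)]
    refine finsum_congr fun U => ?_
    split_ifs with hU
    · have h := zeroCount_top (Q.restrict U) (isNondegenerate_restrict_iff_finrank.2 hU.2)
      rw [zeroCount_restrict_top, hU.1] at h
      simp only [eval_sub, eval_pow, eval_X, eval_one, eval_mul, pow_one, pow_zero]
      rw [h]
      ring
    · simp

/-- The chain in `V` which starts with `V` and continues with the images of a chain in `A`. -/
def consChain {k V : Type*} [Field k] [AddCommGroup V] [Module k V] (A : Submodule k V)
    (W : ℕ → Submodule k A) : ℕ → Submodule k V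
  | 0 => ⊤
  | n + 1 => (W n).map A.subtype

theorem isNondegenerate_restrict_top {k V : Type*} [Field k] [AddCommGroup V] [Module k V]
    {Q : QuadraticForm k V} (hQ : IsNondegenerate Q) : IsNondegenerate (Q.restrict ⊤) :=
  isNondegenerate_of_equiv Submodule.topEquiv.symm (fun _ => rfl) hQ

section Cons

variable {k V : Type*} [Field k] [AddCommGroup V] [Module k V] [FiniteDimensional k V]
  {Q : QuadraticForm k V} {r : ℕ → ℕ}

theorem chains_zero_eq_top (hV : finrank k V = r 0) {U : ℕ → Submodule k V} (hU : U ∈ chains Q r) :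
    U 0 = ⊤ :=
  Submodule.eq_top_of_finrank_eq ((hU.2 0).1.trans hV.symm)

theorem consChain_mem_chains (hV : finrank k V = r 0) (hQ : IsNondegenerate Q) {A : Submodule k V}
    {W : ℕ → Submodule k A} (hW : W ∈ chains (Q.restrict A) fun n => r (n + 1)) :
    consChain A W ∈ chains Q r := by
  refine ⟨antitone_nat_of_succ_le fun n => ?_, fun n => ?_⟩
  · cases n with
    | zero => exact le_top
    | succ n => exact Submodule.map_mono (hW.1 (Nat.le_succ n))
  · cases n with
    | zero => exact ⟨by rw [consChain, finrank_top, hV], isNondegenerate_restrict_top hQ⟩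
    | succ n =>
      exact ⟨(finrank_map_subtype' A (W n)).trans (hW.2 n).1,
        (isNondegenerate_restrict_restrict_iff Q A (W n)).1 (hW.2 n).2⟩

/-- Chains in `V` amount to a choice of their second member and a chain in it. -/
noncomputable def chainsEquiv (hV : finrank k V = r 0) (hQ : IsNondegenerate Q) :
    (Σ A : {A : Submodule k V // finrank k A = r 1 ∧ finrank k (singRad Q A) = 0},
      chains (Q.restrict A.1) fun n => r (n + 1)) ≃ chains Q r :=
  Equiv.ofBijective (fun p => ⟨consChain p.1.1 p.2.1, consChain_mem_chains hV hQ p.2.2⟩) <| by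
    constructor
    · rintro ⟨⟨A, hA⟩, W, hW⟩ ⟨⟨A', hA'⟩, W', hW'⟩ h
      have h0 : consChain A W = consChain A' W' := Subtype.mk.inj h
      -- The first member of a chain in `A` is all of `A`, so the second member of the extended
      -- chain recovers `A`.
      have h1 : A = A' := by
        have := congrFun h0 1
        simpa only [consChain, chains_zero_eq_top (Q := Q.restrict A) hA.1 hW,
          chains_zero_eq_top (Q := Q.restrict A') hA'.1 hW', Submodule.map_subtype_top] using this
      subst h1
      have h2 : W = W' := funext fun n =>
        Submodule.map_injective_of_injective A.injective_subtype (congrFun h0 (n + 1))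
      subst h2
      rfl
    · rintro ⟨U, hU⟩
      have hmap : ∀ n, ((U (n + 1)).comap (U 1).subtype).map (U 1).subtype = U (n + 1) := by
        intro n
        rw [Submodule.map_comap_subtype, inf_eq_right]
        exact hU.1 (by lia)
      refine ⟨⟨⟨U 1, (hU.2 1).1, isNondegenerate_restrict_iff_finrank.1 (hU.2 1).2⟩,
        fun n => (U (n + 1)).comap (U 1).subtype, fun m n hmn =>
          Submodule.comap_mono (hU.1 (by lia)), fun n => ⟨?_, ?_⟩⟩, Subtype.ext (funext fun n => ?_)⟩
      · rw [← finrank_map_subtype', hmap]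
        exact (hU.2 (n + 1)).1
      · rw [isNondegenerate_restrict_restrict_iff, hmap]
        exact (hU.2 (n + 1)).2
      · cases n with
        | zero => exact (chains_zero_eq_top hV hU).symm
        | succ n => exact hmap n

theorem chains_of_forall_eq_zero (hr : ∀ n, r n = 0) : chains Q r = {fun _ => ⊥} := by
  ext U
  constructor
  · intro hU
    exact funext fun n => Submodule.finrank_eq_zero.1 ((hU.2 n).1.trans (hr n))
  · rintro rfl
    refine ⟨antitone_const, fun n => ⟨by rw [finrank_bot, hr], ?_⟩⟩
    rw [isNondegenerate_restrict_iff_finrank, Submodule.finrank_eq_zero]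
    exact le_bot_iff.1 (singRad_le _ _)

end Cons

theorem chains_finite (N : ℕ) (r : ℕ → ℕ) (hr : ∀ n, N ≤ n → r n = 0) {k : Type*} [Field k]
    [Finite k] {V : Type*} [AddCommGroup V] [Module k V] [FiniteDimensional k V]
    (Q : QuadraticForm k V) (hV : finrank k V = r 0) (hQ : IsNondegenerate Q) :
    (chains Q r).Finite := by
  induction N generalizing r V with
  | zero =>
    rw [chains_of_forall_eq_zero fun n => hr n n.zero_le]
    exact Set.finite_singleton _
  | succ N ih =>
    have : Finite V := Module.finite_of_finite k
    have : ∀ A : {A : Submodule k V // finrank k A = r 1 ∧ finrank k (singRad Q A) = 0},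
        Finite (chains (Q.restrict A.1) fun n => r (n + 1)) := fun A =>
      ih (fun n => r (n + 1)) (fun n hn => hr (n + 1) (by lia)) (Q.restrict A.1) A.2.1
        (isNondegenerate_restrict_iff_finrank.2 A.2.2)
    exact Finite.of_equiv _ (chainsEquiv hV hQ)

/-- The number of chains, as an integer. -/
noncomputable def chainCount (r : ℕ → ℕ) (k : Type*) [Field k] (V : Type*) [AddCommGroup V]
    [Module k V] (Q : QuadraticForm k V) : ℤ :=
  (chains Q r).ncard

/-- Each second member `A` carries `C(q) + sgn(A) D(q)` chains by induction; summing over `A` gives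
`C` times the number of such `A` plus `D` times their type sum. -/
theorem isPoly_chainCount (N : ℕ) (r : ℕ → ℕ) (hr : ∀ n, N ≤ n → r n = 0) :
    IsPoly.{u, v} (r 0) (chainCount r) := by
  induction N generalizing r with
  | zero =>
    refine (isPoly_eval 1).congr fun k _ _ V _ _ _ Q _ _ => ?_
    rw [chainCount, chains_of_forall_eq_zero fun n => hr n n.zero_le]
    simp
  | succ N ih =>
    have hr' : ∀ n, N ≤ n → (fun n => r (n + 1)) n = 0 := fun n hn => hr (n + 1) (by lia)
    obtain ⟨C, D, hCD⟩ := ih (fun n => r (n + 1)) hr'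
    refine (((isPoly_eval C).mul
      (isPoly_radSum 0 (fun m n => isPoly_totalSum_zero m n) (r 1) (r 0) 0)).add
        ((isPoly_eval D).mul (isPoly_typeSum (r 1) (r 0)))).congr ?_
    intro k _ _ V _ _ _ Q hV hQ
    classical
    have : Finite V := Module.finite_of_finite k
    have := Fintype.ofFinite (Submodule k V)
    have : ∀ A : {A : Submodule k V // finrank k A = r 1 ∧ finrank k (singRad Q A) = 0},
        Finite (chains (Q.restrict A.1) fun n => r (n + 1)) := fun A =>
      chains_finite N _ hr' (Q.restrict A.1) A.2.1 (isNondegenerate_restrict_iff_finrank.2 A.2.2)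
    rw [chainCount, ← Nat.card_coe_set_eq, ← Nat.card_congr (chainsEquiv hV hQ), Nat.card_sigma,
      Nat.cast_sum, radSum, typeSum, mul_finsum, mul_finsum,
      ← finsum_add_distrib (Set.toFinite _) (Set.toFinite _), finsum_eq_sum_of_fintype]
    have hterm : ∀ A : {A : Submodule k V // finrank k A = r 1 ∧ finrank k (singRad Q A) = 0},
        (Nat.card (chains (Q.restrict A.1) fun n => r (n + 1)) : ℤ) =
          C.eval (Nat.card k : ℤ) + D.eval (Nat.card k : ℤ) * sgn (Q.restrict A.1) := by
      intro A
      rw [mul_comm (D.eval _)]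
      exact hCD k A.1 (Q.restrict A.1) A.2.1 (isNondegenerate_restrict_iff_finrank.2 A.2.2)
    rw [Finset.sum_congr rfl fun A _ => hterm A]
    rw [← Finset.sum_subtype (Finset.univ.filter fun A : Submodule k V =>
      finrank k A = r 1 ∧ finrank k (singRad Q A) = 0) (by simp) fun A =>
        C.eval (Nat.card k : ℤ) + D.eval (Nat.card k : ℤ) * sgn (Q.restrict A), Finset.sum_filter]
    refine Finset.sum_congr rfl fun A _ => ?_
    split_ifs <;> simp

end Chains

end QuadChains

theorem mainTheorem4 (r : ℕ → ℕ) (hr : Antitone r) (hr0 : ∃ N, ∀ n, N ≤ n → r n = 0) :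
    (Odd (r 0) →
      ∃ P : Polynomial ℤ,
        ∀ (k : Type*) [Field k] [Finite k]
          (V : Type*) [AddCommGroup V] [Module k V] [FiniteDimensional k V]
          (Q : QuadraticForm k V),
          Module.finrank k V = r 0 → QuadChains.IsNondegenerate Q →
          (QuadChains.chains Q r).Finite ∧
            ((QuadChains.chains Q r).ncard : ℤ) = P.eval (Nat.card k : ℤ)) ∧
    (Even (r 0) → 2 ≤ r 0 → ∀ ε : ℤˣ,
      ∃ P : Polynomial ℤ,
        ∀ (k : Type*) [Field k] [Finite k]
          (V : Type*) [AddCommGroup V] [Module k V] [FiniteDimensional k V]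
          (Q : QuadraticForm k V),
          Module.finrank k V = r 0 → QuadChains.IsNondegenerate Q →
          QuadChains.formType Q = ε →
          (QuadChains.chains Q r).Finite ∧
            ((QuadChains.chains Q r).ncard : ℤ) = P.eval (Nat.card k : ℤ)) := by
  obtain ⟨N, hN⟩ := hr0
  constructor
  · intro hodd
    obtain ⟨C, D, hCD⟩ := QuadChains.isPoly_chainCount N r hN
    refine ⟨C, fun k _ _ V _ _ _ Q hV hQ => ⟨QuadChains.chains_finite N r hN Q hV hQ, ?_⟩⟩
    have h := hCD k V Q hV hQ
    rwa [QuadChains.sgn_odd (hV ▸ Nat.not_even_iff_odd.2 hodd), zero_mul, add_zero] at h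
  · intro heven _ ε
    obtain ⟨C, D, hCD⟩ := QuadChains.isPoly_chainCount N r hN
    refine ⟨C + Polynomial.C (ε : ℤ) * D, fun k _ _ V _ _ _ Q hV hQ hε =>
      ⟨QuadChains.chains_finite N r hN Q hV hQ, ?_⟩⟩
    have h := hCD k V Q hV hQ
    rw [QuadChains.sgn_even (hV ▸ heven), hε] at h
    rw [Polynomial.eval_add, Polynomial.eval_mul, Polynomial.eval_C]
    exact h
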